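/- Let $a,b,c,d,e,f,g\in\mathbb C$ satisfy $e+f+g-a-b-c-d=1$. Assume that $e\notin\mathbb Z$ and that none of $f,\ g,\ 1+f-e,\ 1+g-e$ and none of $a,\ b,\ c,\ d,\ 1+a-e,\ 1+b-e,\ 1+c-e,\ 1+d-e$ belongs to $\{0,-1,-2,\dots\}$. Write $(x)_n=x(x+1)\cdots(x+n-1)$, $(x)_0=1$, $$ {}_4F_3\!\left[{a_1,a_2,a_3,a_4\atop b_1,b_2,b_3};1\right]=\sum_{n=0}^\infty\frac{(a_1)_n(a_2)_n(a_3)_n(a_4)_n}{n!\,(b_1)_n(b_2)_n(b_3)_n},$$ and define $$ L(a,b,c,d;e;f,g)=\frac{{}_4F_3\!\left[{a,b,c,d\atop e,f,g};1\right]}{\sin(\pi e)\,\Gamma(e)\Gamma(f)\Gamma(g)\Gamma(1+a-e)\Gamma(1+b-e)\Gamma(1+c-e)\Gamma(1+d-e)} -\frac{{}_4F_3\!\left[{1+a-e,1+b-e,1+c-e,1+d-e\atop 1+f-e,1+g-e,2-e};1\right]}{\sin(\pi e)\,\Gamma(a)\Gamma(b)\Gamma(c)\Gamma(d)\Gamma(1+f-e)\Gamma(1+g-e)\Gamma(2-e)},$$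 where both series converge absolutely. A Barnes contour is the imaginary axis, traversed upwards and indented if necessary (a simple piecewise $C^1$ path that agrees with the imaginary axis outside a bounded set), so that the poles of $\frac{\Gamma(a+t)\Gamma(b+t)\Gamma(c+t)\Gamma(d+t)}{\Gamma(f+t)\Gamma(g+t)}$ lie to its left and the poles of $\Gamma(1-e-t)\Gamma(-t)$ lie to its right. Then Barnes contours exist, and for every Barnes contour the integral below converges absolutely and $$ L(a,b,c,d;e;f,g)=\frac{1}{\pi\,\Gamma(a)\Gamma(b)\Gamma(c)\Gamma(d)\Gamma(1+a-e)\Gamma(1+b-e)\Gamma(1+c-e)\Gamma(1+d-e)}\cdot\frac1{2\pi i}\int_t\frac{\Gamma(a+t)\Gamma(b+t)\Gamma(c+t)\Gamma(d+t)\Gamma(1-e-t)\Gamma(-t)}{\Gamma(f+t)\Gamma(g+t)}\,dt .$$ -/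

import Mathlib

noncomputable section

/-- The `n`-th term of the hypergeometric series with lists of numerator parameters `as` and
denominator parameters `bs` at `z`:
`∏ (a_i)_n / (n! ∏ (b_j)_n) * z ^ n`, where `(x)_n` is the rising factorial. -/
def hypergeometricTerm (as bs : List ℂ) (z : ℂ) (n : ℕ) : ℂ :=
  (as.map fun x => (ascPochhammer ℂ n).eval x).prod /
    ((n.factorial : ℂ) * (bs.map fun x => (ascPochhammer ℂ n).eval x).prod) * z ^ n

/-- The generalized hypergeometric series (the sum over all `n` of its terms). -/
def hypergeometricSeries (as bs : List ℂ) (z : ℂ) : ℂ :=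
  ∑' n : ℕ, hypergeometricTerm as bs z n

/-- The function `L(a, b, c, d; e; f, g)`: a linear combination of two `₄F₃(1)` series. -/
def LFunction (a b c d e f g : ℂ) : ℂ :=
  hypergeometricSeries [a, b, c, d] [e, f, g] 1 /
      (Complex.sin (Real.pi * e) * Complex.Gamma e * Complex.Gamma f * Complex.Gamma g *
        Complex.Gamma (1 + a - e) * Complex.Gamma (1 + b - e) *
        Complex.Gamma (1 + c - e) * Complex.Gamma (1 + d - e)) -
    hypergeometricSeries [1 + a - e, 1 + b - e, 1 + c - e, 1 + d - e]
        [1 + f - e, 1 + g - e, 2 - e] 1 /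
      (Complex.sin (Real.pi * e) * Complex.Gamma a * Complex.Gamma b * Complex.Gamma c *
        Complex.Gamma d * Complex.Gamma (1 + f - e) * Complex.Gamma (1 + g - e) *
        Complex.Gamma (2 - e))

/-- `p` is zero or a negative integer. -/
def IsNonposInt (p : ℂ) : Prop := ∃ n : ℕ, p = -(n : ℂ)

/-- `F` has a pole at `p`: its order there is negative. -/
def HasPoleAt (F : ℂ → ℂ) (p : ℂ) : Prop := meromorphicOrderAt F p < 0

/-- The imaginary axis, traversed upwards and possibly indented: a simple piecewise `C¹` path
which coincides with the imaginary axis outside a bounded parameter interval. -/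
structure IsIndentedImaginaryAxis (γ : ℝ → ℂ) : Prop where
  continuous : Continuous γ
  injective : Function.Injective γ
  /-- `γ` is `C¹` off a finite set, with bounded derivative. -/
  piecewise_C1 : ∃ (S : Finset ℝ) (C : ℝ), ∀ y : ℝ, y ∉ S →
    DifferentiableAt ℝ γ y ∧ ContinuousAt (deriv γ) y ∧ ‖deriv γ y‖ ≤ C
  eq_axis : ∃ R : ℝ, ∀ y : ℝ, R ≤ |y| → γ y = (y : ℂ) * Complex.I

/-- `p` lies off the path `γ`, on its left: it can be joined, without meeting `γ`, to all
real numbers near `-∞`. -/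
def LiesLeftOf (γ : ℝ → ℂ) (p : ℂ) : Prop :=
  ∃ x₀ : ℝ, ∀ x : ℝ, x ≤ x₀ → JoinedIn (Set.range γ)ᶜ p (x : ℂ)

/-- `p` lies off the path `γ`, on its right: it can be joined, without meeting `γ`, to all
real numbers near `+∞`. -/
def LiesRightOf (γ : ℝ → ℂ) (p : ℂ) : Prop :=
  ∃ x₀ : ℝ, ∀ x : ℝ, x₀ ≤ x → JoinedIn (Set.range γ)ᶜ p (x : ℂ)

/-- `γ` is a path of integration for the Barnes integral of `F * G`, where `F` is the product of
the factors `Γ(a_i + t)^{±1}` and `G` is the product of the factors `Γ(b_j - t)^{±1}`. -/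
structure IsBarnesContour (F G : ℂ → ℂ) (γ : ℝ → ℂ) : Prop where
  indented_axis : IsIndentedImaginaryAxis γ
  poles_left : ∀ p : ℂ, HasPoleAt F p → LiesLeftOf γ p
  poles_right : ∀ p : ℂ, HasPoleAt G p → LiesRightOf γ p

/-- The factors of the integrand with argument of the form `a_i + t`. -/
def barnesLeftFactor (a b c d f g t : ℂ) : ℂ :=
  Complex.Gamma (a + t) * Complex.Gamma (b + t) * Complex.Gamma (c + t) * Complex.Gamma (d + t) /
    (Complex.Gamma (f + t) * Complex.Gamma (g + t))

/-- The factors of the integrand with argument of the form `b_j - t`. -/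
def barnesRightFactor (e t : ℂ) : ℂ :=
  Complex.Gamma (1 - e - t) * Complex.Gamma (-t)

/-- The integrand `F(γ(y)) G(γ(y)) γ'(y)` of a Barnes integral along `γ`, in the parameter. -/
def barnesIntegrand (F G : ℂ → ℂ) (γ : ℝ → ℂ) (y : ℝ) : ℂ :=
  F (γ y) * G (γ y) * deriv γ y

/-- The contour integral `∫_γ F(t) G(t) dt`. -/
def barnesIntegral (F G : ℂ → ℂ) (γ : ℝ → ℂ) : ℂ :=
  ∫ y : ℝ, barnesIntegrand F G γ y

end

open Complex Filter Topology Set MeasureTheory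
open scoped Manifold

/-! Write `Φ` for the integrand, `barnesProduct`. Since `e` is not an integer, the poles of
`Γ(1-e-t)Γ(-t)` form two disjoint sequences of simple poles, `t = n` and `t = 1-e+n`. By the
reflection formula the residues of `Φ` there are `-κ H(n)` and `κ H(1-e+n)`, with `κ = π / sin(πe)`
and `H(t)` the left factor divided by `Γ(e+t)Γ(1+t)`. The functional equation of `Γ` shows that
`H(n)/H(0)` and `H(1-e+n)/H(1-e)` are the terms of the two `₄F₃` series. Pushing the contour to `re
= +∞` therefore gives `∫ Φ = 2πi κ (A - B)`, where `A` and `B` are the sums of the two sequences,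
and the Gamma prefactor turns this into `L`.

The Saalschützian condition enters through one number: counting the lower parameter `1` that
represents `n!`, the lower parameters exceed the upper ones by `2` in total. Hence the terms are
`O(n⁻²)` (`summable_pochhammerRatio`). The same excess gives `|Φ(t+1)| ≤ |Φ(t)|` on a right
half-plane (`exists_norm_barnesProduct_add_one_le`), so the integrals over `re = x + N` are
dominated by the one over `re = x` and tend to `0` (`barnes_integral_eq`).

The contour is moved without winding numbers. The principal value of `∫ dt/(t-p)` along a vertical
path is locally constant in `p` off the path, and equals `πi` for `p` on the left and `-πi` for `p`
on the right. After subtraction of principal parts the integrand is analytic on a strip and has a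
primitive there, so only these principal values remain (`integral_sub_integral_eq_sum_residues`).
The decay this needs comes from Beta integrals and the exponential growth of the sine
(`exists_norm_barnes_le`).

A Barnes contour is built as a graph over a sheared height `im + ε re`, with `ε` chosen so that no
left pole and right pole that matter share a height (`exists_indentedImaginaryAxis_separating`). -/

/-! ### Vertical paths -/

/-- A piecewise `C¹` path that agrees with the vertical line `re = x` outside a bounded parameter
interval. -/
structure IsVerticalPath (x : ℝ) (γ : ℝ → ℂ) : Prop where
  continuous : Continuous γ
  piecewise_C1 : ∃ (S : Finset ℝ) (C : ℝ), ∀ y : ℝ, y ∉ S →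
    DifferentiableAt ℝ γ y ∧ ContinuousAt (deriv γ) y ∧ ‖deriv γ y‖ ≤ C
  eq_line : ∃ R : ℝ, ∀ y : ℝ, R ≤ |y| → γ y = x + (y : ℂ) * I

theorem IsIndentedImaginaryAxis.isVerticalPath {γ : ℝ → ℂ} (h : IsIndentedImaginaryAxis γ) :
    IsVerticalPath 0 γ where
  continuous := h.continuous
  piecewise_C1 := h.piecewise_C1
  eq_line := by simpa using h.eq_axis

theorem hasDerivAt_verticalLine (x y : ℝ) :
    HasDerivAt (fun y : ℝ => (x + (y : ℂ) * I : ℂ)) I y := by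
  simpa using ((Complex.ofRealCLM.hasDerivAt (x := y)).mul_const I).const_add (x : ℂ)

theorem isVerticalPath_line (x : ℝ) : IsVerticalPath x (fun y : ℝ => (x + (y : ℂ) * I : ℂ)) where
  continuous := by fun_prop
  piecewise_C1 := ⟨∅, 1, fun y _ => by
    have h : deriv (fun y : ℝ => (x + (y : ℂ) * I : ℂ)) = fun _ => I :=
      funext fun y => (hasDerivAt_verticalLine x y).deriv
    refine ⟨(hasDerivAt_verticalLine x y).differentiableAt, ?_, ?_⟩ <;> rw [h]
    · fun_prop
    · simp⟩
  eq_line := ⟨0, fun _ _ => rfl⟩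

namespace IsVerticalPath

variable {x : ℝ} {γ : ℝ → ℂ}

theorem intervalIntegrable_deriv (hγ : IsVerticalPath x γ) (a b : ℝ) :
    IntervalIntegrable (deriv γ) volume a b := by
  obtain ⟨S, C, h⟩ := hγ.piecewise_C1
  refine (intervalIntegrable_const (c := C)).mono_fun (measurable_deriv γ).aestronglyMeasurable ?_
  have : ∀ᵐ y : ℝ, y ∉ S := S.countable_toSet.ae_notMem volume
  filter_upwards [ae_restrict_of_ae this] with y hy
  exact (h y hy).2.2.trans (le_abs_self C)

theorem intervalIntegrable_mul_deriv (hγ : IsVerticalPath x γ) {h : ℂ → ℂ}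
    (hh : Continuous fun y => h (γ y)) (a b : ℝ) :
    IntervalIntegrable (fun y => h (γ y) * deriv γ y) volume a b :=
  (hγ.intervalIntegrable_deriv a b).continuousOn_mul hh.continuousOn

theorem integral_eq_sub (hγ : IsVerticalPath x γ) {h H : ℂ → ℂ}
    (hh : Continuous fun y => h (γ y)) (hH : ∀ y, HasDerivAt H (h (γ y)) (γ y)) (a b : ℝ) :
    ∫ y in a..b, h (γ y) * deriv γ y = H (γ b) - H (γ a) := by
  obtain ⟨S, C, hS⟩ := hγ.piecewise_C1
  refine integral_eq_of_hasDerivAt_off_countable (fun y => H (γ y)) _ S.countable_toSet ?_ ?_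
    (hγ.intervalIntegrable_mul_deriv hh a b)
  · intro y _
    exact ((hH y).continuousAt.comp hγ.continuous.continuousAt).continuousWithinAt
  · intro y hy
    exact (hH y).comp y (hS y hy.2).1.hasDerivAt

theorem isClosed_range (hγ : IsVerticalPath x γ) : IsClosed (range γ) := by
  obtain ⟨R, hR⟩ := hγ.eq_line
  -- A compact arc together with a closed part of the line `re = x`.
  have : range γ = γ '' (Icc (-R) R) ∪ {z : ℂ | z.re = x ∧ R ≤ |z.im|} := by
    ext z
    constructor
    · rintro ⟨y, rfl⟩
      by_cases hy : R ≤ |y|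
      · right; rw [hR y hy]; simpa using hy
      · left; exact ⟨y, abs_le.mp (not_le.mp hy).le, rfl⟩
    · rintro (⟨y, -, rfl⟩ | ⟨h1, h2⟩)
      · exact ⟨y, rfl⟩
      · exact ⟨z.im, by rw [hR _ h2, ← h1, re_add_im]⟩
  rw [this]
  refine (isCompact_Icc.image hγ.continuous).isClosed.union ?_
  exact (isClosed_eq continuous_re continuous_const).inter
    (isClosed_le continuous_const (continuous_abs.comp continuous_im))

theorem exists_bound_re (hγ : IsVerticalPath x γ) : ∃ M, ∀ y, |(γ y).re| ≤ M := by
  obtain ⟨R, hR⟩ := hγ.eq_line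
  obtain ⟨M, hM⟩ := (isCompact_Icc (a := -R) (b := R)).exists_bound_of_continuousOn
    (hγ.continuous.continuousOn)
  refine ⟨max M |x|, fun y => ?_⟩
  by_cases hy : R ≤ |y|
  · rw [hR y hy]; simp
  · exact ((abs_re_le_norm _).trans (hM y (abs_le.mp (not_le.mp hy).le))).trans (le_max_left _ _)

theorem eventually_eq (hγ : IsVerticalPath x γ) :
    ∀ᶠ Y : ℝ in atTop, γ Y = x + Y * I ∧ γ (-Y) = x - Y * I := by
  obtain ⟨R, hR⟩ := hγ.eq_line
  filter_upwards [eventually_ge_atTop R] with Y hY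
  refine ⟨hR _ (hY.trans (le_abs_self Y)), ?_⟩
  rw [hR _ (by rw [abs_neg]; exact hY.trans (le_abs_self Y))]
  push_cast; ring

theorem tendsto_cobounded_top (hγ : IsVerticalPath x γ) :
    Tendsto γ atTop (Bornology.cobounded ℂ) := by
  rw [← tendsto_norm_atTop_iff_cobounded]
  refine tendsto_atTop_mono' _ ?_ tendsto_id
  filter_upwards [hγ.eventually_eq] with Y hY
  calc Y ≤ |(γ Y).im| := by rw [hY.1]; simpa using le_abs_self Y
    _ ≤ _ := abs_im_le_norm _

theorem tendsto_cobounded_bot (hγ : IsVerticalPath x γ) :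
    Tendsto (fun Y => γ (-Y)) atTop (Bornology.cobounded ℂ) := by
  rw [← tendsto_norm_atTop_iff_cobounded]
  refine tendsto_atTop_mono' _ ?_ tendsto_id
  filter_upwards [hγ.eventually_eq] with Y hY
  calc Y ≤ |(γ (-Y)).im| := by rw [hY.2]; simpa using le_abs_self Y
    _ ≤ _ := abs_im_le_norm _

end IsVerticalPath

/-! ### Principal values of the integral of `1/(t - p)` -/

/-- The principal value, for symmetric exhaustion of the parameter interval, of the contour
integral of `h` along `γ` is `v`. -/
def HasPVIntegral (γ : ℝ → ℂ) (h : ℂ → ℂ) (v : ℂ) : Prop :=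
  Tendsto (fun Y : ℝ => ∫ y in (-Y)..Y, h (γ y) * deriv γ y) atTop (𝓝 v)

theorem tendsto_inv_sub_cobounded (q : ℂ) :
    Tendsto (fun t : ℂ => (t - q)⁻¹) (Bornology.cobounded ℂ) (𝓝 0) :=
  tendsto_inv₀_cobounded.comp (tendsto_sub_const_cobounded q)

/-- If the quotient equals `-r` with `r ≥ 0`, then `t = (q + r q') / (1 + r)` is a convex
combination of `q` and `q'`. -/
theorem sub_div_sub_mem_slitPlane {t q q' : ℂ} (ht : t ∉ segment ℝ q q') :
    (t - q) / (t - q') ∈ slitPlane := by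
  have hq' : t - q' ≠ 0 := fun h => ht (sub_eq_zero.mp h ▸ right_mem_segment ℝ q q')
  by_contra hcon
  rw [mem_slitPlane_iff, not_or, not_lt, not_not] at hcon
  obtain ⟨h1, h2⟩ := hcon
  set r := -((t - q) / (t - q')).re with hr
  have hr0 : 0 ≤ r := by linarith
  have : (t - q) / (t - q') = ((-r : ℝ) : ℂ) := by
    apply Complex.ext <;> simp [hr, h2]
  rw [div_eq_iff hq'] at this
  apply ht
  rw [segment_eq_image]
  refine ⟨r / (1 + r), ⟨by positivity, (div_le_one (by positivity)).2 (by linarith)⟩, ?_⟩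
  have h1r : (1 + r : ℂ) ≠ 0 := by
    have : (1 + r : ℝ) ≠ 0 := by positivity
    exact_mod_cast this
  have : t = (q + r * q') / (1 + r) := by
    rw [eq_div_iff h1r]; push_cast at this; linear_combination this
  simp only [real_smul]
  push_cast
  rw [this]
  field_simp
  ring

/-- The difference of the two integrands has the primitive `log ((t - q) / (t - q'))`, which is
single-valued off the segment and tends to `0` at infinity. -/
theorem IsVerticalPath.hasPVIntegral_inv_sub_of_segment {x : ℝ} {γ : ℝ → ℂ}
    (hγ : IsVerticalPath x γ) {q q' v : ℂ} (hq : ∀ y, γ y ∉ segment ℝ q q')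
    (h : HasPVIntegral γ (fun t => (t - q)⁻¹) v) : HasPVIntegral γ (fun t => (t - q')⁻¹) v := by
  have hne : ∀ y, γ y - q ≠ 0 := fun y h0 => hq y (sub_eq_zero.mp h0 ▸ left_mem_segment ℝ q q')
  have hne' : ∀ y, γ y - q' ≠ 0 := fun y h0 => hq y (sub_eq_zero.mp h0 ▸ right_mem_segment ℝ q q')
  have hc := hγ.continuous
  have c1 : Continuous fun y => (γ y - q)⁻¹ := (hc.sub continuous_const).inv₀ hne
  have c2 : Continuous fun y => (γ y - q')⁻¹ := (hc.sub continuous_const).inv₀ hne'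
  set H : ℂ → ℂ := fun t => log ((t - q) / (t - q')) with hH
  have hd : ∀ y, HasDerivAt H ((γ y - q)⁻¹ - (γ y - q')⁻¹) (γ y) := by
    intro y
    have h1 : HasDerivAt (fun t : ℂ => (t - q) / (t - q'))
        ((1 * (γ y - q') - (γ y - q) * 1) / (γ y - q') ^ 2) (γ y) :=
      ((hasDerivAt_id _).sub_const q).div ((hasDerivAt_id _).sub_const q') (hne' y)
    convert! h1.clog (sub_div_sub_mem_slitPlane (hq y)) using 1
    have := hne y; have := hne' y
    field_simp
  have hlim : Tendsto H (Bornology.cobounded ℂ) (𝓝 0) := by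
    have e : ∀ᶠ t : ℂ in Bornology.cobounded ℂ, 1 + (q' - q) * (t - q')⁻¹ = (t - q) / (t - q') := by
      filter_upwards [Bornology.eventually_ne_cobounded q'] with t ht
      have : t - q' ≠ 0 := sub_ne_zero.mpr ht
      field_simp
      ring
    have : Tendsto (fun t : ℂ => (t - q) / (t - q')) (Bornology.cobounded ℂ) (𝓝 1) := by
      refine Tendsto.congr' e ?_
      simpa using ((tendsto_inv_sub_cobounded q').const_mul (q' - q)).const_add 1
    simpa using this.clog (by simp)
  have h2 : Tendsto (fun Y => H (γ Y) - H (γ (-Y))) atTop (𝓝 (0 - 0)) :=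
    (hlim.comp hγ.tendsto_cobounded_top).sub (hlim.comp hγ.tendsto_cobounded_bot)
  have h3 := Tendsto.sub h h2
  rw [sub_zero, sub_zero] at h3
  refine h3.congr fun Y => ?_
  rw [← hγ.integral_eq_sub (h := fun t => (t - q)⁻¹ - (t - q')⁻¹) (c1.sub c2) hd,
    ← intervalIntegral.integral_sub (hγ.intervalIntegrable_mul_deriv (h := fun t => (t - q)⁻¹) c1 _ _)
      (hγ.intervalIntegrable_mul_deriv (h := fun t => (t - q)⁻¹ - (t - q')⁻¹) (c1.sub c2) _ _)]
  exact intervalIntegral.integral_congr fun y _ => by ring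

/-- The range of `γ` is closed, so nearby points of the joining path are ends of a segment that
avoids `γ`. The truth value of the claim is thus locally constant along the joining path. -/
theorem IsVerticalPath.hasPVIntegral_inv_sub_of_joinedIn {x : ℝ} {γ : ℝ → ℂ}
    (hγ : IsVerticalPath x γ) {p q v : ℂ} (hpq : JoinedIn (range γ)ᶜ p q)
    (h : HasPVIntegral γ (fun t => (t - q)⁻¹) v) : HasPVIntegral γ (fun t => (t - p)⁻¹) v := by
  obtain ⟨φ, hφ⟩ := hpq
  have hlc : IsLocallyConstant fun s => HasPVIntegral γ (fun t => (t - φ s)⁻¹) v := by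
    rw [IsLocallyConstant.iff_eventually_eq]
    intro s
    obtain ⟨ε, hε, hball⟩ := Metric.isOpen_iff.mp hγ.isClosed_range.isOpen_compl _ (hφ s)
    have hnear : ∀ᶠ s' in 𝓝 s, φ s' ∈ Metric.ball (φ s) ε :=
      φ.continuous.continuousAt.eventually (Metric.ball_mem_nhds _ hε)
    filter_upwards [hnear] with s' hs'
    have hseg : ∀ y, γ y ∉ segment ℝ (φ s) (φ s') := fun y hy =>
      hball ((convex_ball _ _).segment_subset (Metric.mem_ball_self hε) hs' hy) (mem_range_self y)
    have hseg' : ∀ y, γ y ∉ segment ℝ (φ s') (φ s) := by simpa only [segment_symm] using hseg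
    exact propext ⟨hγ.hasPVIntegral_inv_sub_of_segment hseg',
      hγ.hasPVIntegral_inv_sub_of_segment hseg⟩
  have := hlc.apply_eq_of_preconnectedSpace 0 1
  simp only [φ.source, φ.target] at this
  exact this.mpr h

/-- The two logarithms are conjugate, so the difference is `2i arg(k + iY) = 2i arctan(Y/k)`. -/
theorem tendsto_log_sub_log_conj (k : ℝ) (hk : 0 < k) :
    Tendsto (fun Y : ℝ => log (k + Y * I) - log (k - Y * I)) atTop (𝓝 (Real.pi * I)) := by
  have harg : ∀ Y : ℝ, log (k + Y * I) - log (k - Y * I) = 2 * (Real.arctan (Y / k) : ℝ) * I := by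
    intro Y
    have h1 : arg (k + Y * I) = Real.arctan (Y / k) := by
      rw [arg_of_re_nonneg (by simpa using hk.le), Real.arctan_eq_arcsin]
      congr 1
      have : ‖(k + Y * I : ℂ)‖ = k * √(1 + (Y / k) ^ 2) := by
        rw [norm_add_mul_I, ← Real.sqrt_sq hk.le, ← Real.sqrt_mul (by positivity),
          Real.sqrt_sq hk.le]
        congr 1; field_simp
      rw [this]
      simp
      field_simp
    have h2 : log (k - Y * I) = (starRingEnd ℂ) (log (k + Y * I)) := by
      rw [← log_conj _ (by rw [h1]; have := Real.arctan_lt_pi_div_two (Y / k); linarith [Real.pi_pos])]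
      simp [sub_eq_add_neg]
    rw [h2, Complex.sub_conj, log_im, h1]
    push_cast; ring
  simp_rw [harg]
  have h1 : Tendsto (fun Y : ℝ => Real.arctan (Y / k)) atTop (𝓝 (Real.pi / 2)) :=
    (tendsto_nhds_of_tendsto_nhdsWithin Real.tendsto_arctan_atTop).comp
      (tendsto_id.atTop_div_const hk)
  have h2 := (((continuous_ofReal.tendsto _).comp h1).const_mul (2 : ℂ)).mul_const I
  convert! h2 using 2
  push_cast; ring

theorem IsVerticalPath.hasPVIntegral_of_integral_eq {x : ℝ} {γ : ℝ → ℂ} (hγ : IsVerticalPath x γ)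
    {h H : ℂ → ℂ} (hh : Continuous fun y => h (γ y)) (hH : ∀ y, HasDerivAt H (h (γ y)) (γ y)) {v : ℂ}
    (hv : Tendsto (fun Y : ℝ => H (x + Y * I) - H (x - Y * I)) atTop (𝓝 v)) :
    HasPVIntegral γ h v := by
  refine hv.congr' ?_
  filter_upwards [hγ.eventually_eq] with Y hY
  rw [hγ.integral_eq_sub hh hH, hY.1, hY.2]

theorem IsVerticalPath.hasPVIntegral_inv_sub_of_lt {x : ℝ} {γ : ℝ → ℂ} (hγ : IsVerticalPath x γ)
    {r : ℝ} (hr : ∀ y, r < (γ y).re) (hrx : r < x) :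
    HasPVIntegral γ (fun t => (t - r)⁻¹) (Real.pi * I) := by
  have hpos : ∀ y, 0 < (γ y - r).re := fun y => by simpa using hr y
  have hne : ∀ y, γ y - r ≠ 0 := fun y h => by have := hpos y; rw [h] at this; simp at this
  refine hγ.hasPVIntegral_of_integral_eq (H := fun t => log (t - r))
    ((hγ.continuous.sub continuous_const).inv₀ hne) (fun y => ?_) ?_
  · simpa using ((hasDerivAt_id (γ y)).sub_const (r : ℂ)).clog (Or.inl (hpos y))
  · refine (tendsto_log_sub_log_conj (x - r) (sub_pos.mpr hrx)).congr fun Y => ?_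
    push_cast
    ring_nf

theorem IsVerticalPath.hasPVIntegral_inv_sub_of_gt {x : ℝ} {γ : ℝ → ℂ} (hγ : IsVerticalPath x γ)
    {r : ℝ} (hr : ∀ y, (γ y).re < r) (hrx : x < r) :
    HasPVIntegral γ (fun t => (t - r)⁻¹) (-(Real.pi * I)) := by
  have hpos : ∀ y, 0 < (r - γ y).re := fun y => by simpa using hr y
  have hne : ∀ y, γ y - r ≠ 0 := fun y h => by
    have := hpos y; rw [← neg_sub, h] at this; simp at this
  refine hγ.hasPVIntegral_of_integral_eq (H := fun t => log (r - t))
    ((hγ.continuous.sub continuous_const).inv₀ hne) (fun y => ?_) ?_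
  · convert! ((hasDerivAt_id (γ y)).const_sub (r : ℂ)).clog (Or.inl (hpos y)) using 1
    rw [← neg_sub, inv_neg, id, neg_div, one_div]
  · refine (tendsto_log_sub_log_conj (r - x) (sub_pos.mpr hrx)).neg.congr fun Y => ?_
    push_cast
    ring_nf

/-- The point `p` can be joined to a real `r` to the left of the whole path, and for such `r` the
principal branch of `log (t - r)` is a primitive along all of `γ`. -/
theorem IsVerticalPath.hasPVIntegral_of_liesLeftOf {x : ℝ} {γ : ℝ → ℂ} (hγ : IsVerticalPath x γ)
    {p : ℂ} (hp : LiesLeftOf γ p) : HasPVIntegral γ (fun t => (t - p)⁻¹) (Real.pi * I) := by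
  obtain ⟨x₀, hx₀⟩ := hp
  obtain ⟨M, hM⟩ := hγ.exists_bound_re
  refine hγ.hasPVIntegral_inv_sub_of_joinedIn (hx₀ (min x₀ (min (-M - 1) (x - 1))) (min_le_left _ _))
    (hγ.hasPVIntegral_inv_sub_of_lt (fun y => ?_) ?_)
  · have := (abs_le.mp (hM y)).1
    have := (min_le_right x₀ (min (-M - 1) (x - 1))).trans (min_le_left _ _)
    linarith
  · have := (min_le_right x₀ (min (-M - 1) (x - 1))).trans (min_le_right _ _)
    linarith

theorem IsVerticalPath.hasPVIntegral_of_liesRightOf {x : ℝ} {γ : ℝ → ℂ} (hγ : IsVerticalPath x γ)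
    {p : ℂ} (hp : LiesRightOf γ p) : HasPVIntegral γ (fun t => (t - p)⁻¹) (-(Real.pi * I)) := by
  obtain ⟨x₀, hx₀⟩ := hp
  obtain ⟨M, hM⟩ := hγ.exists_bound_re
  refine hγ.hasPVIntegral_inv_sub_of_joinedIn (hx₀ (max x₀ (max (M + 1) (x + 1))) (le_max_left _ _))
    (hγ.hasPVIntegral_inv_sub_of_gt (fun y => ?_) ?_)
  · have := (abs_le.mp (hM y)).2
    have := (le_max_left (M + 1) (x + 1)).trans (le_max_right x₀ _)
    linarith
  · have := (le_max_right (M + 1) (x + 1)).trans (le_max_right x₀ _)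
    linarith

theorem hasPVIntegral_verticalLine_of_lt {x : ℝ} {p : ℂ} (hp : p.re < x) :
    HasPVIntegral (fun y : ℝ => (x + (y : ℂ) * I : ℂ)) (fun t => (t - p)⁻¹) (Real.pi * I) := by
  refine (isVerticalPath_line x).hasPVIntegral_inv_sub_of_joinedIn (q := (p.re : ℂ)) ?_
    ((isVerticalPath_line x).hasPVIntegral_inv_sub_of_lt (fun y => by simpa using hp) hp)
  have hconv : Convex ℝ {z : ℂ | z.re < x} := convex_halfSpace_re_lt x
  refine (JoinedIn.of_segment_subset (hconv.segment_subset hp (by simpa using hp))).mono ?_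
  rintro z hz ⟨y, rfl⟩
  simp at hz

/-! ### Principal parts, and primitives on convex sets -/

theorem IsVerticalPath.hasPVIntegral_inv_pow {x : ℝ} {γ : ℝ → ℂ} (hγ : IsVerticalPath x γ)
    {p : ℂ} (hp : p ∉ range γ) (k : ℕ) : HasPVIntegral γ (fun t => ((t - p) ^ (k + 2))⁻¹) 0 := by
  have hne : ∀ y, γ y - p ≠ 0 := fun y h => hp ⟨y, sub_eq_zero.mp h⟩
  set H : ℂ → ℂ := fun t => -((k + 1 : ℂ)⁻¹) * ((t - p)⁻¹) ^ (k + 1) with hH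
  have hk : (k + 1 : ℂ) ≠ 0 := Nat.cast_add_one_ne_zero k
  have hlim : Tendsto H (Bornology.cobounded ℂ) (𝓝 0) := by
    convert! ((tendsto_inv_sub_cobounded p).pow (k + 1)).const_mul (-((k + 1 : ℂ)⁻¹)) using 2
    simp
  have h2 : Tendsto (fun Y => H (γ Y) - H (γ (-Y))) atTop (𝓝 (0 - 0)) :=
    (hlim.comp hγ.tendsto_cobounded_top).sub (hlim.comp hγ.tendsto_cobounded_bot)
  rw [sub_zero] at h2
  refine h2.congr fun Y => (hγ.integral_eq_sub (h := fun t => ((t - p) ^ (k + 2))⁻¹)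
    (((hγ.continuous.sub continuous_const).pow _).inv₀ fun y => pow_ne_zero _ (hne y)) ?_ _ _).symm
  intro y
  have h1 := ((((hasDerivAt_id (γ y)).sub_const p).fun_inv (hne y)).fun_pow (k + 1)).const_mul
    (-((k + 1 : ℂ)⁻¹))
  convert! h1 using 1
  have := hne y
  simp only [id]
  push_cast
  rw [inv_pow]
  field_simp
  ring

/-- The function `∑_{k ≤ n} c_k (t - p)^{-(k+1)}`. -/
noncomputable def principalPart (p : ℂ) (n : ℕ) (c : ℕ → ℂ) (t : ℂ) : ℂ :=
  ∑ k ∈ Finset.range (n + 1), c k * ((t - p) ^ (k + 1))⁻¹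

theorem analyticAt_principalPart {p z : ℂ} (n : ℕ) (c : ℕ → ℂ) (hz : z ≠ p) :
    AnalyticAt ℂ (principalPart p n c) z := by
  unfold principalPart
  refine Finset.analyticAt_fun_sum _ fun k _ => ?_
  have : (z - p) ^ (k + 1) ≠ 0 := pow_ne_zero _ (sub_ne_zero.mpr hz)
  fun_prop (disch := assumption)

theorem meromorphic_principalPart (p : ℂ) (n : ℕ) (c : ℕ → ℂ) :
    Meromorphic (principalPart p n c) := by
  intro z
  unfold principalPart
  refine MeromorphicAt.fun_sum fun k _ => ?_
  have h : AnalyticAt ℂ (fun t : ℂ => (t - p) ^ (k + 1)) z := by fun_prop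
  exact (MeromorphicAt.const (c k) z).mul h.meromorphicAt.inv

theorem tendsto_principalPart_cobounded (p : ℂ) (n : ℕ) (c : ℕ → ℂ) :
    Tendsto (principalPart p n c) (Bornology.cobounded ℂ) (𝓝 0) := by
  unfold principalPart
  rw [show (0 : ℂ) = ∑ k ∈ Finset.range (n + 1), 0 by simp]
  refine tendsto_finsetSum _ fun k _ => ?_
  convert! ((tendsto_inv_sub_cobounded p).pow (k + 1)).const_mul (c k) using 2 <;> simp

/-- Induction on the order of the pole: removing `g p / (z - p) ^ (n + 1)` replaces `g` by its
divided difference `dslope g p`, which is again analytic, and lowers the order by one. -/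
theorem exists_principalPart_of_eventuallyEq {p : ℂ} (n : ℕ) {f g : ℂ → ℂ} (hg : AnalyticAt ℂ g p)
    (hfg : ∀ᶠ z in 𝓝[≠] p, f z = ((z - p) ^ n)⁻¹ * g z) :
    ∃ (m : ℕ) (c : ℕ → ℂ) (h : ℂ → ℂ), AnalyticAt ℂ h p ∧
      ∀ᶠ z in 𝓝[≠] p, f z - principalPart p m c z = h z := by
  induction n generalizing f g with
  | zero =>
    exact ⟨0, 0, g, hg, by filter_upwards [hfg] with z hz; simp [principalPart, hz]⟩
  | succ n ih =>
    obtain ⟨ps, hps⟩ := hg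
    have hd : AnalyticAt ℂ (dslope g p) p := ⟨_, hps.has_fpower_series_dslope_fslope⟩
    obtain ⟨m, c, h, hh, he⟩ := ih (f := fun z => f z - g p * ((z - p) ^ (n + 1))⁻¹) hd (by
      filter_upwards [hfg, self_mem_nhdsWithin] with z hz hne
      have : z - p ≠ 0 := sub_ne_zero.mpr hne
      rw [hz, dslope_of_ne _ hne, slope_def_field]
      field_simp
      ring)
    -- The coefficient of `(z - p)⁻⁽ⁿ⁺¹⁾` has index `n`. The range of summation may become longer
    -- than that of `c`, so `c` is cut off after `m`.
    refine ⟨max m n, fun k => (if k ≤ m then c k else 0) + if k = n then g p else 0, h, hh, ?_⟩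
    filter_upwards [he] with z hz
    rw [← hz]
    simp only [principalPart, add_mul, Finset.sum_add_distrib, ite_mul, zero_mul]
    rw [Finset.sum_ite_eq' , if_pos (by simp),
      ← Finset.sum_filter]
    have : Finset.filter (fun k => k ≤ m) (Finset.range (max m n + 1)) = Finset.range (m + 1) := by
      ext k; simp; omega
    rw [this]
    ring

theorem MeromorphicAt.exists_principalPart {f : ℂ → ℂ} {p : ℂ} (hf : MeromorphicAt f p) :
    ∃ (m : ℕ) (c : ℕ → ℂ), 0 ≤ meromorphicOrderAt (fun z => f z - principalPart p m c z) p := by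
  obtain ⟨n, hn⟩ := hf
  obtain ⟨m, c, h, hh, he⟩ := exists_principalPart_of_eventuallyEq (f := f) n hn (by
    filter_upwards [self_mem_nhdsWithin] with z hne
    have : z - p ≠ 0 := sub_ne_zero.mpr hne
    rw [smul_eq_mul]
    field_simp)
  refine ⟨m, c, ?_⟩
  rw [meromorphicOrderAt_congr he]
  exact hh.meromorphicOrderAt_nonneg

/-- After multiplication by `z - p` the difference tends to `0`, so that product has order at least
`1`. Orders being integers, the difference itself has order at least `0`. -/
theorem meromorphicOrderAt_sub_simple_pole {f : ℂ → ℂ} {p r : ℂ} (hf : MeromorphicAt f p)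
    (hr : Tendsto (fun t => (t - p) * f t) (𝓝[≠] p) (𝓝 r)) :
    0 ≤ meromorphicOrderAt (fun z => f z - principalPart p 0 (fun _ => r) z) p := by
  have hm : MeromorphicAt (fun z => f z - principalPart p 0 (fun _ => r) z) p :=
    hf.sub (meromorphic_principalPart p 0 _ p)
  have hid : MeromorphicAt (fun z : ℂ => z - p) p := (by fun_prop : AnalyticAt ℂ _ p).meromorphicAt
  have h0 : 0 < meromorphicOrderAt (fun z => (z - p) * (f z - principalPart p 0 (fun _ => r) z)) p := by
    refine (tendsto_zero_iff_meromorphicOrderAt_pos (hid.mul hm)).mp ?_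
    have := hr.sub_const r
    rw [sub_self] at this
    refine this.congr' ?_
    filter_upwards [self_mem_nhdsWithin] with z hne
    have : z - p ≠ 0 := sub_ne_zero.mpr hne
    simp [principalPart]
    field_simp
  replace h0 := h0.trans_eq (meromorphicOrderAt_mul hid hm)
  have h1 : meromorphicOrderAt (fun z : ℂ => z - p) p = 1 := meromorphicOrderAt_id_sub_const
  rw [h1] at h0
  revert h0
  cases meromorphicOrderAt (fun z => f z - principalPart p 0 (fun _ => r) z) p with
  | top => simp
  | coe k =>
    intro h0
    have : (0 : ℤ) < 1 + k := by exact_mod_cast h0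
    exact_mod_cast (by omega : (0 : ℤ) ≤ k)

/-- A meromorphic function with finitely many poles in an open set is there the sum of its principal
parts and an analytic function. -/
theorem MeromorphicOn.exists_analyticOnNhd_sub_principalPart {f : ℂ → ℂ} {U : Set ℂ}
    (hf : MeromorphicOn f U) (P : Finset ℂ) (n : ℂ → ℕ) (c : ℂ → ℕ → ℂ)
    (hP : ∀ p ∈ P, 0 ≤ meromorphicOrderAt (fun z => f z - principalPart p (n p) (c p) z) p)
    (hnP : ∀ z ∈ U, z ∉ P → 0 ≤ meromorphicOrderAt f z) :
    ∃ h : ℂ → ℂ, AnalyticOnNhd ℂ h U ∧ ∀ z ∈ U, AnalyticAt ℂ f z → z ∉ P →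
      f z = h z + ∑ p ∈ P, principalPart p (n p) (c p) z := by
  set h₀ : ℂ → ℂ := fun z => f z - ∑ p ∈ P, principalPart p (n p) (c p) z with hh₀
  have hmer : MeromorphicOn h₀ U := fun z hz =>
    (hf z hz).sub (MeromorphicAt.fun_sum fun p _ => meromorphic_principalPart p _ _ z)
  have hsum : ∀ (Q : Finset ℂ) (z : ℂ), z ∉ Q →
      AnalyticAt ℂ (fun z => ∑ p ∈ Q, principalPart p (n p) (c p) z) z := fun Q z hz =>
    Finset.analyticAt_fun_sum _ fun p hp => analyticAt_principalPart _ _ fun h => hz (h ▸ hp)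
  have hord : ∀ z ∈ U, 0 ≤ meromorphicOrderAt h₀ z := by
    intro z hz
    by_cases hzP : z ∈ P
    · have ha := hsum (P.erase z) z (Finset.notMem_erase z P)
      have e : h₀ = (fun w => f w - principalPart z (n z) (c z) w) +
          -(fun w => ∑ p ∈ P.erase z, principalPart p (n p) (c p) w) := by
        ext w
        simp only [hh₀, Pi.add_apply, Pi.neg_apply]
        rw [← Finset.add_sum_erase _ _ hzP]
        ring
      rw [e]
      refine le_trans (le_min (hP z hzP) ha.neg.meromorphicOrderAt_nonneg)
        (meromorphicOrderAt_add ((hf z hz).sub (meromorphic_principalPart z _ _ z))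
          ha.neg.meromorphicAt)
    · have ha := hsum P z hzP
      have e : h₀ = f + -(fun w => ∑ p ∈ P, principalPart p (n p) (c p) w) := by
        ext w; simp only [hh₀, Pi.add_apply, Pi.neg_apply]; ring
      rw [e]
      exact le_trans (le_min (hnP z hz hzP) ha.neg.meromorphicOrderAt_nonneg)
        (meromorphicOrderAt_add (hf z hz) ha.neg.meromorphicAt)
  -- The difference has only removable singularities, but its values there are arbitrary; the normal
  -- form corrects them.
  refine ⟨toMeromorphicNFOn h₀ U, fun z hz => ?_, fun z hz hfz hzP => ?_⟩
  · rw [← (meromorphicNFOn_toMeromorphicNFOn h₀ U hz).meromorphicOrderAt_nonneg_iff_analyticAt,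
      meromorphicOrderAt_toMeromorphicNFOn hmer hz]
    exact hord z hz
  · have ha : AnalyticAt ℂ h₀ z := hfz.sub (hsum P z hzP)
    rw [toMeromorphicNFOn_eq_toMeromorphicNFAt hmer hz, toMeromorphicNFAt_eq_self.mpr ha.meromorphicNFAt]
    simp [hh₀]

/-- Poincaré lemma for the form `h(z) dz`: its real derivative is symmetric because multiplication
in `ℂ` is commutative. -/
theorem exists_primitive_of_convex {U : Set ℂ} (hU : Convex ℝ U) (hUo : IsOpen U) {h : ℂ → ℂ}
    (hh : DifferentiableOn ℂ h U) : ∃ H : ℂ → ℂ, ∀ z ∈ U, HasDerivAt H (h z) z := by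
  have hd : ∀ a ∈ U, HasFDerivAt (𝕜 := ℝ) (fun z => ContinuousLinearMap.toSpanSingleton ℂ (h z))
      (((ContinuousLinearMap.toSpanSingletonCLE (𝕜 := ℂ) (E := ℂ)).toContinuousLinearMap.restrictScalars ℝ).comp
        ((fderiv ℂ h a).restrictScalars ℝ)) a := by
    intro a ha
    have h1 := ((hh a ha).differentiableAt (hUo.mem_nhds ha)).hasFDerivAt.restrictScalars ℝ
    exact (((ContinuousLinearMap.toSpanSingletonCLE (𝕜 := ℂ) (E := ℂ)).toContinuousLinearMap.restrictScalars ℝ).hasFDerivAt).comp a h1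
  obtain ⟨H, hH⟩ := hU.exists_forall_hasFDerivAt_of_fderiv_symmetric (𝕜 := ℂ) hUo
    (ω := fun z => ContinuousLinearMap.toSpanSingleton ℂ (h z))
    (fun a ha => (hd a ha).differentiableAt.differentiableWithinAt) (fun a ha x y => by
      rw [(hd a ha).fderiv]
      simp
      ring)
  refine ⟨H, fun z hz => ?_⟩
  simpa using (hH z hz).hasDerivAt

theorem HasPVIntegral.const_mul {γ : ℝ → ℂ} {h : ℂ → ℂ} {v : ℂ} (hh : HasPVIntegral γ h v) (c : ℂ) :
    HasPVIntegral γ (fun t => c * h t) (c * v) := by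
  refine (Tendsto.const_mul c hh).congr fun Y => ?_
  rw [← intervalIntegral.integral_const_mul]
  exact intervalIntegral.integral_congr fun y _ => by ring

theorem IsVerticalPath.hasPVIntegral_sum {x : ℝ} {γ : ℝ → ℂ} (hγ : IsVerticalPath x γ) {ι : Type*}
    (s : Finset ι) {h : ι → ℂ → ℂ} {v : ι → ℂ} (hc : ∀ i ∈ s, Continuous fun y => h i (γ y))
    (hh : ∀ i ∈ s, HasPVIntegral γ (h i) (v i)) :
    HasPVIntegral γ (fun t => ∑ i ∈ s, h i t) (∑ i ∈ s, v i) := by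
  refine (tendsto_finsetSum s hh).congr fun Y => ?_
  rw [← intervalIntegral.integral_finsetSum fun i hi => hγ.intervalIntegrable_mul_deriv (hc i hi) _ _]
  exact intervalIntegral.integral_congr fun y _ => by simp only [Finset.sum_mul]

theorem continuous_principalPart_comp {γ : ℝ → ℂ} (hγ : Continuous γ) {p : ℂ} (hp : p ∉ range γ)
    (n : ℕ) (c : ℕ → ℂ) : Continuous fun y => principalPart p n c (γ y) :=
  continuous_iff_continuousAt.mpr fun y =>
    (analyticAt_principalPart n c (z := γ y) fun h => hp ⟨y, h⟩).continuousAt.comp hγ.continuousAt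

theorem IsVerticalPath.hasPVIntegral_principalPart {x : ℝ} {γ : ℝ → ℂ} (hγ : IsVerticalPath x γ)
    {p w : ℂ} (hp : p ∉ range γ) (hw : HasPVIntegral γ (fun t => (t - p)⁻¹) w)
    (n : ℕ) (c : ℕ → ℂ) : HasPVIntegral γ (principalPart p n c) (c 0 * w) := by
  have hne : ∀ y, γ y - p ≠ 0 := fun y h => hp ⟨y, sub_eq_zero.mp h⟩
  have h1 := hγ.hasPVIntegral_sum (Finset.range (n + 1))
    (h := fun k t => c k * ((t - p) ^ (k + 1))⁻¹) (v := fun k => if k = 0 then c 0 * w else 0)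
    (fun k _ => continuous_const.mul
      (((hγ.continuous.sub continuous_const).pow _).inv₀ fun y => pow_ne_zero _ (hne y)))
    (fun k _ => by
      rcases k with _ | k
      · simpa using hw.const_mul (c 0)
      · simpa using (hγ.hasPVIntegral_inv_pow hp k).const_mul (c (k + 1)))
  rw [Finset.sum_ite_eq', if_pos (by simp)] at h1
  exact h1

/-! ### Moving a vertical path across poles -/

theorem IsVerticalPath.eventually_norm_deriv {x : ℝ} {γ : ℝ → ℂ} (hγ : IsVerticalPath x γ) :
    ∃ R : ℝ, ∀ y, R ≤ |y| → γ y = x + (y : ℂ) * I ∧ ‖deriv γ y‖ = 1 := by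
  obtain ⟨R, hR⟩ := hγ.eq_line
  refine ⟨R + 1, fun y hy => ⟨hR y (by linarith), ?_⟩⟩
  have : γ =ᶠ[𝓝 y] fun y : ℝ => (x + (y : ℂ) * I : ℂ) := by
    have : ∀ᶠ z in 𝓝 y, R < |z| :=
      continuous_abs.continuousAt.eventually (lt_mem_nhds (by linarith))
    filter_upwards [this] with z hz using hR z hz.le
  rw [this.deriv_eq, (hasDerivAt_verticalLine x y).deriv, norm_I]

theorem IsVerticalPath.integrable_of_decay {x : ℝ} {γ : ℝ → ℂ} (hγ : IsVerticalPath x γ)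
    {f g : ℂ → ℂ} (hg : Continuous fun y => g (γ y)) (hfg : ∀ᵐ y : ℝ, f (γ y) = g (γ y))
    {C T : ℝ} (hC : ∀ t : ℂ, t.re = x → T ≤ |t.im| → ‖f t‖ ≤ C / t.im ^ 2) :
    Integrable fun y => f (γ y) * deriv γ y := by
  obtain ⟨R, hR⟩ := hγ.eventually_norm_deriv
  have hae : (fun y => f (γ y) * deriv γ y) =ᵐ[volume] fun y => g (γ y) * deriv γ y := by
    filter_upwards [hfg] with y hy
    rw [hy]
  set K := max (max R T) 1 with hK
  have hK1 : 1 ≤ K := le_max_right _ _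
  have hKR : R ≤ K := (le_max_left _ _).trans (le_max_left _ _)
  have hKT : T ≤ K := (le_max_right _ _).trans (le_max_left _ _)
  have hmeas : AEStronglyMeasurable (fun y => f (γ y) * deriv γ y) volume :=
    ((hg.measurable.mul (measurable_deriv γ)).aestronglyMeasurable).congr hae.symm
  have hI : IntegrableOn (fun y => f (γ y) * deriv γ y) (Ioc (-K) K) := by
    have h1 := hγ.intervalIntegrable_mul_deriv hg (-K) K
    rw [intervalIntegrable_iff_integrableOn_Ioc_of_le (by linarith)] at h1
    exact h1.congr_fun_ae (ae_restrict_of_ae hae.symm)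
  rw [← integrableOn_univ, ← union_compl_self (Ioc (-K) K)]
  refine hI.union ?_
  -- The factor `2` comes from `1 / y² ≤ 2 / (1 + y²)` for `y² ≥ 1`.
  refine Integrable.mono' ((integrable_inv_one_add_sq.const_mul (2 * C)).integrableOn
    (s := (Ioc (-K) K)ᶜ)) hmeas.restrict ?_
  filter_upwards [ae_restrict_mem measurableSet_Ioc.compl] with y hy
  have hy' : K ≤ |y| := by
    by_contra hcon
    have := abs_lt.mp (not_le.mp hcon)
    exact hy ⟨this.1, this.2.le⟩
  obtain ⟨h1, h2⟩ := hR y (hKR.trans hy')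
  rw [norm_mul, h2, mul_one]
  have h3 := hC (γ y) (by rw [h1]; simp) (by rw [h1]; simpa using hKT.trans hy')
  have h4 : (γ y).im = y := by rw [h1]; simp
  rw [h4] at h3
  have hy2 : 1 ≤ y ^ 2 := by
    rw [← sq_abs]; nlinarith
  have hC0 : 0 ≤ C := by
    have := (norm_nonneg _).trans h3
    by_contra hcon
    have := div_neg_of_neg_of_pos (not_le.mp hcon) (by linarith : 0 < y ^ 2)
    linarith
  refine h3.trans ?_
  rw [← div_eq_mul_inv, div_le_div_iff₀ (by linarith) (by linarith)]
  nlinarith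

/-- The path may run through points where a pole of `f` cancels and the value of `f` is not the
limit. Non-analytic points are countable and `γ` is injective, so `f` agrees almost everywhere along
`γ` with the continuous function `g`. -/
theorem IsVerticalPath.integrable_and_hasPVIntegral {x : ℝ} {γ : ℝ → ℂ} (hγ : IsVerticalPath x γ)
    (hinj : Function.Injective γ) {U : Set ℂ} (hU : ∀ y, γ y ∈ U) {f h : ℂ → ℂ}
    (hf : MeromorphicOn f U) (hh : AnalyticOnNhd ℂ h U) {P : Finset ℂ} {n : ℂ → ℕ} {c : ℂ → ℕ → ℂ}
    (hfh : ∀ z ∈ U, AnalyticAt ℂ f z → z ∉ P →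
      f z = h z + ∑ p ∈ P, principalPart p (n p) (c p) z)
    {w : ℂ → ℂ} (hP : ∀ p ∈ P, p ∉ range γ)
    (hw : ∀ p ∈ P, HasPVIntegral γ (fun t => (t - p)⁻¹) (w p))
    {C T : ℝ} (hC : ∀ t : ℂ, t.re = x → T ≤ |t.im| → ‖f t‖ ≤ C / t.im ^ 2) :
    Integrable (fun y => f (γ y) * deriv γ y) ∧
      HasPVIntegral γ h ((∫ y, f (γ y) * deriv γ y) - ∑ p ∈ P, c p 0 * w p) := by
  set g : ℂ → ℂ := fun z => h z + ∑ p ∈ P, principalPart p (n p) (c p) z with hg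
  have hc1 : Continuous fun y => h (γ y) := continuous_iff_continuousAt.mpr fun y =>
    ContinuousAt.comp (hh _ (hU y)).continuousAt hγ.continuous.continuousAt
  have hc2 : ∀ p ∈ P, Continuous fun y => principalPart p (n p) (c p) (γ y) := fun p hp =>
    continuous_principalPart_comp hγ.continuous (hP p hp) _ _
  have hc3 : Continuous fun y => ∑ p ∈ P, principalPart p (n p) (c p) (γ y) :=
    continuous_finsetSum _ hc2
  have hcg : Continuous fun y => g (γ y) := hc1.add hc3
  have hae : ∀ᵐ y : ℝ, f (γ y) = g (γ y) := by
    have hcount : ({z | AnalyticAt ℂ f z}ᶜ ∩ U).Countable := hf.countable_compl_analyticAt_inter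
    have h1 := (hcount.preimage_of_injOn (f := γ) hinj.injOn).ae_notMem volume
    filter_upwards [h1] with y hy
    refine hfh _ (hU y) ?_ fun hyP => hP _ hyP ⟨y, rfl⟩
    by_contra hcon
    exact hy ⟨hcon, hU y⟩
  have hint := hγ.integrable_of_decay hcg hae hC
  refine ⟨hint, ?_⟩
  have h1 : HasPVIntegral γ g (∫ y, f (γ y) * deriv γ y) := by
    refine (intervalIntegral_tendsto_integral hint tendsto_neg_atTop_atBot tendsto_id).congr
      fun Y => ?_
    refine intervalIntegral.integral_congr_ae ?_
    filter_upwards [hae] with y hy _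
    rw [hy]
  have h2 := hγ.hasPVIntegral_sum P hc2 fun p hp =>
    hγ.hasPVIntegral_principalPart (hP p hp) (hw p hp) (n p) (c p)
  refine (Tendsto.sub h1 h2).congr fun Y => ?_
  rw [← intervalIntegral.integral_sub (hγ.intervalIntegrable_mul_deriv hcg _ _)
    (hγ.intervalIntegrable_mul_deriv (h := fun t => ∑ p ∈ P, principalPart p (n p) (c p) t) hc3 _ _)]
  exact intervalIntegral.integral_congr fun y _ => by simp only [hg]; ring

/-- Moving a vertical path of integration of a meromorphic function that decays in the strip between
the two paths changes the integral by residues. -/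
theorem integral_sub_integral_eq_sum_residues {x x' : ℝ} (hxx' : x ≤ x') {γ γ' : ℝ → ℂ}
    (hγ : IsVerticalPath x γ) (hγ' : IsVerticalPath x' γ')
    (hinj : Function.Injective γ) (hinj' : Function.Injective γ') {x₁ x₂ : ℝ}
    (hU : ∀ y, γ y ∈ re ⁻¹' Ioo x₁ x₂) (hU' : ∀ y, γ' y ∈ re ⁻¹' Ioo x₁ x₂) {f : ℂ → ℂ}
    (hf : MeromorphicOn f (re ⁻¹' Ioo x₁ x₂)) (P : Finset ℂ) (n : ℂ → ℕ) (c : ℂ → ℕ → ℂ)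
    (hord : ∀ p ∈ P, 0 ≤ meromorphicOrderAt (fun z => f z - principalPart p (n p) (c p) z) p)
    (hord' : ∀ z ∈ re ⁻¹' Ioo x₁ x₂, z ∉ P → 0 ≤ meromorphicOrderAt f z)
    {w w' : ℂ → ℂ} (hP : ∀ p ∈ P, p ∉ range γ) (hP' : ∀ p ∈ P, p ∉ range γ')
    (hw : ∀ p ∈ P, HasPVIntegral γ (fun t => (t - p)⁻¹) (w p))
    (hw' : ∀ p ∈ P, HasPVIntegral γ' (fun t => (t - p)⁻¹) (w' p))
    {C T : ℝ} (hC : ∀ t : ℂ, t.re ∈ Icc x x' → T ≤ |t.im| →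
      AnalyticAt ℂ f t ∧ ‖f t‖ ≤ C / t.im ^ 2) :
    Integrable (fun y => f (γ y) * deriv γ y) ∧ Integrable (fun y => f (γ' y) * deriv γ' y) ∧
      (∫ y, f (γ y) * deriv γ y) - ∫ y, f (γ' y) * deriv γ' y =
        ∑ p ∈ P, c p 0 * (w p - w' p) := by
  have hUo : IsOpen (re ⁻¹' Ioo x₁ x₂) := isOpen_Ioo.preimage continuous_re
  have hUc : Convex ℝ (re ⁻¹' Ioo x₁ x₂) := (convex_Ioo x₁ x₂).linear_preimage reLm
  obtain ⟨h, hh, hfh⟩ := hf.exists_analyticOnNhd_sub_principalPart P n c hord hord'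
  obtain ⟨i1, pv1⟩ := hγ.integrable_and_hasPVIntegral hinj hU hf hh hfh hP hw
    (fun t ht hT => (hC t ⟨ht.ge, ht.le.trans hxx'⟩ hT).2)
  obtain ⟨i2, pv2⟩ := hγ'.integrable_and_hasPVIntegral hinj' hU' hf hh hfh hP' hw'
    (fun t ht hT => (hC t ⟨hxx'.trans ht.ge, ht.le⟩ hT).2)
  refine ⟨i1, i2, ?_⟩
  obtain ⟨H, hH⟩ := exists_primitive_of_convex hUc hUo hh.differentiableOn
  have hx1 : x₁ < x := by
    obtain ⟨Y, hY, -⟩ := hγ.eventually_eq.exists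
    have := (hU Y).1; rw [hY] at this; simpa using this
  have hx2 : x' < x₂ := by
    obtain ⟨Y, hY, -⟩ := hγ'.eventually_eq.exists
    have := (hU' Y).2; rw [hY] at this; simpa using this
  have hmem : ∀ t : ℂ, t.re ∈ Icc x x' → t ∈ re ⁻¹' Ioo x₁ x₂ := fun t ht =>
    ⟨hx1.trans_le ht.1, ht.2.trans_lt hx2⟩
  -- High up in the strip `h` is small, since `f` decays and principal parts vanish at infinity.
  have hsmall : ∀ ε > 0, ∃ Y₀ : ℝ, ∀ t : ℂ, t.re ∈ Icc x x' → Y₀ ≤ |t.im| → ‖h t‖ ≤ ε := by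
    intro ε hε
    have hs : Tendsto (fun t => ∑ p ∈ P, principalPart p (n p) (c p) t) (Bornology.cobounded ℂ)
        (𝓝 0) := by
      rw [show (0 : ℂ) = ∑ p ∈ P, 0 by simp]
      exact tendsto_finsetSum _ fun p _ => tendsto_principalPart_cobounded _ _ _
    have hev : ∀ᶠ t in Bornology.cobounded ℂ, ‖∑ p ∈ P, principalPart p (n p) (c p) t‖ < ε / 2 ∧
        t ∉ P := by
      refine (hs.norm.eventually (gt_mem_nhds (by simpa using half_pos hε))).and ?_
      exact (show Bornology.IsBounded (P : Set ℂ) from P.finite_toSet.isBounded)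
    rw [← comap_norm_atTop, Filter.eventually_comap, eventually_atTop] at hev
    obtain ⟨R, hR⟩ := hev
    refine ⟨max (max R T) (max 1 (2 * |C| / ε)), fun t ht hY => ?_⟩
    have y1 : R ≤ |t.im| := ((le_max_left _ _).trans (le_max_left _ _)).trans hY
    have y2 : T ≤ |t.im| := ((le_max_right _ _).trans (le_max_left _ _)).trans hY
    have y3 : 1 ≤ |t.im| := ((le_max_left _ _).trans (le_max_right _ _)).trans hY
    have y4 : 2 * |C| / ε ≤ |t.im| := ((le_max_right _ _).trans (le_max_right _ _)).trans hY
    obtain ⟨hs1, hs2⟩ := hR ‖t‖ (y1.trans (abs_im_le_norm t)) t rfl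
    obtain ⟨ha, hb⟩ := hC t ht y2
    have e := hfh t (hmem t ht) ha hs2
    have : ‖f t‖ ≤ ε / 2 := by
      refine hb.trans ?_
      rw [div_le_iff₀ (by rw [← sq_abs]; positivity), ← sq_abs]
      rw [div_le_iff₀ hε] at y4
      have := le_abs_self C
      have : |t.im| ≤ |t.im| ^ 2 := by nlinarith
      nlinarith
    rw [eq_sub_of_add_eq e.symm]
    exact (norm_sub_le _ _).trans (by linarith)
  -- The signs `s = ±1` give the top and bottom edges joining the two paths. The summand `1` in `x'
  -- - x + 1` keeps the denominator positive when `x = x'`.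
  have hseg : ∀ s : ℝ, s ^ 2 = 1 →
      Tendsto (fun Y : ℝ => H (x' + s * Y * I) - H (x + s * Y * I)) atTop (𝓝 0) := by
    intro s hs
    rw [Metric.tendsto_atTop]
    intro ε hε
    obtain ⟨Y₀, hY₀⟩ := hsmall (ε / (x' - x + 1)) (div_pos hε (by linarith))
    refine ⟨Y₀, fun Y hY => ?_⟩
    have habs : |s * Y| = |Y| := by rw [abs_mul, ← Real.sqrt_sq_eq_abs s, hs, Real.sqrt_one, one_mul]
    have hconv : Convex ℝ {t : ℂ | t.re ∈ Icc x x' ∧ t.im = s * Y} :=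
      ((convex_Icc x x').linear_preimage reLm).inter
        ((convex_singleton (s * Y)).linear_preimage imLm)
    have hb := hconv.norm_image_sub_le_of_norm_hasDerivWithin_le (f := H) (f' := h)
      (C := ε / (x' - x + 1)) (x := x + s * Y * I) (y := x' + s * Y * I)
      (fun t ht => (hH t (hmem t ht.1)).hasDerivWithinAt)
      (fun t ht => hY₀ t ht.1 (by rw [ht.2, habs]; exact hY.trans (le_abs_self Y)))
      (by simp [hxx']) (by simp [hxx'])
    rw [dist_zero_right]
    refine hb.trans_lt ?_
    have : ‖(x' + s * Y * I : ℂ) - (x + s * Y * I)‖ = x' - x := by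
      rw [add_sub_add_right_eq_sub, ← ofReal_sub, norm_real, Real.norm_of_nonneg (by linarith)]
    rw [this, div_mul_eq_mul_div, div_lt_iff₀ (by linarith)]
    nlinarith
  -- By the primitive `H`, the difference of the two truncated integrals of `h` is a difference of
  -- increments of `H` over the two edges, which tends to `0`.
  have hlim := Tendsto.sub pv1 pv2
  have hlim0 := ((hseg (-1) (by norm_num)).sub (hseg 1 (by norm_num)))
  have huniq := tendsto_nhds_unique hlim (hlim0.congr' ?_)
  · rw [sub_zero] at huniq
    simp only [mul_sub, Finset.sum_sub_distrib]
    linear_combination huniq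
  · have hc : Continuous fun y => h (γ y) := continuous_iff_continuousAt.mpr fun y =>
      ContinuousAt.comp (hh _ (hU y)).continuousAt hγ.continuous.continuousAt
    have hc' : Continuous fun y => h (γ' y) := continuous_iff_continuousAt.mpr fun y =>
      ContinuousAt.comp (hh _ (hU' y)).continuousAt hγ'.continuous.continuousAt
    filter_upwards [hγ.eventually_eq, hγ'.eventually_eq] with Y h1 h2
    rw [hγ.integral_eq_sub hc (fun y => hH _ (hU y)), hγ'.integral_eq_sub hc' (fun y => hH _ (hU' y)),
      h1.1, h1.2, h2.1, h2.2]
    push_cast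
    ring_nf

/-! ### Construction of an indented imaginary axis separating two sets -/

/-- The path that is the graph `re = h` over the sheared coordinate `im + ε re`. -/
noncomputable def shearedGraph (ε : ℝ) (h : ℝ → ℝ) (y : ℝ) : ℂ := h y + ((y - ε * h y : ℝ) : ℂ) * I

theorem shearedGraph_re (ε : ℝ) (h : ℝ → ℝ) (y : ℝ) : (shearedGraph ε h y).re = h y := by
  simp [shearedGraph]

theorem shearedGraph_im (ε : ℝ) (h : ℝ → ℝ) (y : ℝ) : (shearedGraph ε h y).im = y - ε * h y := by
  simp [shearedGraph]

/-- The parameter is thus recovered from the point: the path is injective, and each line `im + ε re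
= c` meets it exactly once. -/
theorem shearedGraph_shear (ε : ℝ) (h : ℝ → ℝ) (y : ℝ) :
    (shearedGraph ε h y).im + ε * (shearedGraph ε h y).re = y := by
  rw [shearedGraph_re, shearedGraph_im]; ring

theorem contDiff_shearedGraph (ε : ℝ) {h : ℝ → ℝ} (hh : ContDiff ℝ 1 h) :
    ContDiff ℝ 1 (shearedGraph ε h) := by
  unfold shearedGraph
  have h1 : ContDiff ℝ 1 fun y => (h y : ℂ) := ofRealCLM.contDiff.comp hh
  have h2 : ContDiff ℝ 1 fun y : ℝ => ((y - ε * h y : ℝ) : ℂ) :=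
    ofRealCLM.contDiff.comp (contDiff_id.sub (contDiff_const.mul hh))
  exact h1.add (h2.mul contDiff_const)

theorem isIndentedImaginaryAxis_shearedGraph (ε : ℝ) {h : ℝ → ℝ} (hh : ContDiff ℝ 1 h) {R : ℝ}
    (hR : ∀ y, R ≤ |y| → h y = 0) : IsIndentedImaginaryAxis (shearedGraph ε h) := by
  have hax : ∀ y : ℝ, R ≤ |y| → shearedGraph ε h y = (y : ℂ) * I := fun y hy => by
    simp [shearedGraph, hR y hy]
  have hd := contDiff_shearedGraph ε hh
  have hdc : Continuous (deriv (shearedGraph ε h)) := hd.continuous_deriv le_rfl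
  refine ⟨hd.continuous, fun y z hyz => ?_, ?_, ⟨R, hax⟩⟩
  · rw [← shearedGraph_shear ε h y, hyz, shearedGraph_shear]
  · obtain ⟨C, hC⟩ := (isCompact_Icc (a := -R) (b := R)).exists_bound_of_continuousOn hdc.continuousOn
    refine ⟨∅, max C 1, fun y _ => ⟨(hd.differentiable one_ne_zero) y, hdc.continuousAt, ?_⟩⟩
    by_cases hy : R < |y|
    · have he : shearedGraph ε h =ᶠ[𝓝 y] fun y : ℝ => ((0 : ℝ) + (y : ℂ) * I : ℂ) := by
        filter_upwards [continuous_abs.continuousAt.eventually (lt_mem_nhds hy)] with z hz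
        simpa using hax z hz.le
      rw [he.deriv_eq, (hasDerivAt_verticalLine 0 y).deriv, norm_I]
      exact le_max_right _ _
    · exact (hC y (abs_le.mp (not_lt.mp hy))).trans (le_max_left _ _)

theorem convex_shear_line (ε c : ℝ) : Convex ℝ {z : ℂ | z.im + ε * z.re = c} :=
  (convex_singleton c).linear_preimage (imLm + ε • reLm)

/-- Moving left along the line of constant `im + ε re` avoids the path and leads beyond its bound
`-M`; from there a segment inside `re < -M` reaches the real axis. -/
theorem liesLeftOf_shearedGraph (ε : ℝ) {h : ℝ → ℝ} {M : ℝ} (hM : ∀ y, |h y| ≤ M) {p : ℂ}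
    (hp : p.re < h (p.im + ε * p.re)) : LiesLeftOf (shearedGraph ε h) p := by
  refine ⟨-M - 1, fun x hx => ?_⟩
  set c := p.im + ε * p.re with hc
  have hMc := (abs_le.mp (hM c)).1
  set q : ℂ := ((-M - 1 : ℝ) : ℂ) + ((c - ε * (-M - 1) : ℝ) : ℂ) * I with hq
  have hqre : q.re = -M - 1 := by simp [hq]
  have hqim : q.im = c - ε * (-M - 1) := by simp [hq]
  have h1 : JoinedIn (range (shearedGraph ε h))ᶜ p q := by
    have hconv : Convex ℝ {z : ℂ | z.re < h c ∧ z.im + ε * z.re = c} :=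
      (convex_halfSpace_re_lt (h c)).inter (convex_shear_line ε c)
    refine (JoinedIn.of_segment_subset (hconv.segment_subset ⟨hp, rfl⟩ ⟨?_, ?_⟩)).mono ?_
    · rw [hqre]; linarith
    · rw [hqre, hqim]; ring
    · rintro z ⟨hz1, hz2⟩ ⟨y, rfl⟩
      rw [shearedGraph_shear] at hz2
      rw [shearedGraph_re, hz2] at hz1
      exact lt_irrefl _ hz1
  have h2 : JoinedIn (range (shearedGraph ε h))ᶜ q x := by
    refine (JoinedIn.of_segment_subset ((convex_halfSpace_re_lt (-M)).segment_subset
      (x := q) (y := (x : ℂ)) ?_ ?_)).mono ?_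
    · rw [mem_ofPred, hqre]; linarith
    · rw [mem_ofPred, ofReal_re]; linarith
    · rintro z hz ⟨y, rfl⟩
      rw [mem_ofPred, shearedGraph_re] at hz
      linarith [(abs_le.mp (hM y)).1]
  exact h1.trans h2

theorem liesRightOf_shearedGraph (ε : ℝ) {h : ℝ → ℝ} {M : ℝ} (hM : ∀ y, |h y| ≤ M) {p : ℂ}
    (hp : h (p.im + ε * p.re) < p.re) : LiesRightOf (shearedGraph ε h) p := by
  refine ⟨M + 1, fun x hx => ?_⟩
  set c := p.im + ε * p.re with hc
  have hMc := (abs_le.mp (hM c)).2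
  set q : ℂ := ((M + 1 : ℝ) : ℂ) + ((c - ε * (M + 1) : ℝ) : ℂ) * I with hq
  have hqre : q.re = M + 1 := by simp [hq]
  have hqim : q.im = c - ε * (M + 1) := by simp [hq]
  have h1 : JoinedIn (range (shearedGraph ε h))ᶜ p q := by
    have hconv : Convex ℝ {z : ℂ | h c < z.re ∧ z.im + ε * z.re = c} :=
      (convex_halfSpace_re_gt (h c)).inter (convex_shear_line ε c)
    refine (JoinedIn.of_segment_subset (hconv.segment_subset ⟨hp, rfl⟩ ⟨?_, ?_⟩)).mono ?_
    · rw [hqre]; linarith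
    · rw [hqre, hqim]; ring
    · rintro z ⟨hz1, hz2⟩ ⟨y, rfl⟩
      rw [shearedGraph_shear] at hz2
      rw [shearedGraph_re, hz2] at hz1
      exact lt_irrefl _ hz1
  have h2 : JoinedIn (range (shearedGraph ε h))ᶜ q x := by
    refine (JoinedIn.of_segment_subset ((convex_halfSpace_re_gt M).segment_subset
      (x := q) (y := (x : ℂ)) ?_ ?_)).mono ?_
    · rw [mem_ofPred, hqre]; linarith
    · rw [mem_ofPred, ofReal_re]; linarith
    · rintro z hz ⟨y, rfl⟩
      rw [mem_ofPred, shearedGraph_re] at hz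
      linarith [(abs_le.mp (hM y)).2]
  exact h1.trans h2

/-- Each pair with different real parts excludes one value of `ε`; a pair with equal real parts has
different imaginary parts and excludes none. -/
theorem exists_shear_ne {A B : Set ℂ} (hA : A.Finite) (hB : B.Finite) (hAB : Disjoint A B) :
    ∃ ε : ℝ, ∀ a ∈ A, ∀ b ∈ B, a.im + ε * a.re ≠ b.im + ε * b.re := by
  obtain ⟨ε, hε⟩ := ((hA.prod hB).image
    fun ab : ℂ × ℂ => (ab.2.im - ab.1.im) / (ab.1.re - ab.2.re)).infinite_compl.nonempty
  refine ⟨ε, fun a ha b hb h => hε ⟨(a, b), ⟨ha, hb⟩, ?_⟩⟩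
  by_cases hre : a.re = b.re
  · have him : a.im = b.im := by rw [hre] at h; linarith
    exact (hAB.ne_of_mem ha hb (Complex.ext hre him)).elim
  · have : a.re - b.re ≠ 0 := sub_ne_zero.mpr hre
    field_simp
    linarith

theorem exists_contDiff_separating {K L : Set ℝ} (hK : K.Finite) (hL : L.Finite)
    (hKL : Disjoint K L) {M : ℝ} (hM : 0 ≤ M) : ∃ (h : ℝ → ℝ) (R : ℝ), ContDiff ℝ 1 h ∧
      (∀ y, R ≤ |y| → h y = 0) ∧ (∀ y, |h y| ≤ M) ∧ (∀ y ∈ K, h y = M) ∧ ∀ y ∈ L, h y = -M := by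
  obtain ⟨R, hR⟩ := (hK.union hL).isBounded.exists_norm_le
  have hout : IsClosed {y : ℝ | R + 1 ≤ |y|} := isClosed_le continuous_const continuous_abs
  have hdK : Disjoint (L ∪ {y : ℝ | R + 1 ≤ |y|}) K := by
    refine disjoint_union_left.mpr ⟨hKL.symm, disjoint_left.mpr fun y hy hyK => ?_⟩
    have := hR y (Or.inl hyK)
    rw [Real.norm_eq_abs] at this
    rw [mem_ofPred] at hy
    linarith
  have hdL : Disjoint (K ∪ {y : ℝ | R + 1 ≤ |y|}) L := by
    refine disjoint_union_left.mpr ⟨hKL, disjoint_left.mpr fun y hy hyL => ?_⟩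
    have := hR y (Or.inr hyL)
    rw [Real.norm_eq_abs] at this
    rw [mem_ofPred] at hy
    linarith
  obtain ⟨φ, φ0, φ1, φI⟩ := exists_contMDiffMap_zero_one_of_isClosed (n := 1) 𝓘(ℝ, ℝ)
    (hL.isClosed.union hout) hK.isClosed hdK
  obtain ⟨ψ, ψ0, ψ1, ψI⟩ := exists_contMDiffMap_zero_one_of_isClosed (n := 1) 𝓘(ℝ, ℝ)
    (hK.isClosed.union hout) hL.isClosed hdL
  refine ⟨fun y => M * (φ y - ψ y), R + 1, ?_, fun y hy => ?_, fun y => ?_, fun y hy => ?_,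
    fun y hy => ?_⟩
  · exact contDiff_const.mul (φ.contMDiff.contDiff.sub ψ.contMDiff.contDiff)
  · simp [φ0 (Or.inr hy), ψ0 (Or.inr hy)]
  · rw [abs_mul, abs_of_nonneg hM]
    refine mul_le_of_le_one_right hM (abs_le.mpr ?_)
    obtain ⟨a1, a2⟩ := φI y
    obtain ⟨b1, b2⟩ := ψI y
    constructor <;> linarith
  · simp [φ1 hy, ψ0 (Or.inl hy)]
  · simp [φ0 (Or.inl hy), ψ1 hy]

/-- Only finitely many points lie on the wrong side of a graph with values in `[-M, M]`. The graph
is set to `M` at the sheared heights of those in `L` and to `-M` at those in `R`; all other points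
are on the correct side because of the bound. -/
theorem exists_indentedImaginaryAxis_separating {L R : Set ℂ} (hLR : Disjoint L R) {M : ℝ}
    (hL : ∀ p ∈ L, p.re < M) (hR : ∀ p ∈ R, -M < p.re) (hM : 0 ≤ M)
    (hLf : {p ∈ L | -M ≤ p.re}.Finite) (hRf : {p ∈ R | p.re ≤ M}.Finite) :
    ∃ γ, IsIndentedImaginaryAxis γ ∧ (∀ p ∈ L, LiesLeftOf γ p) ∧ ∀ p ∈ R, LiesRightOf γ p := by
  obtain ⟨ε, hε⟩ := exists_shear_ne hLf hRf (hLR.mono (sep_subset _ _) (sep_subset _ _))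
  obtain ⟨h, T, hd, hT, hbd, hhL, hhR⟩ := exists_contDiff_separating
    (hLf.image fun p => p.im + ε * p.re) (hRf.image fun p => p.im + ε * p.re) (by
      rw [disjoint_left]
      rintro _ ⟨a, ha, rfl⟩ ⟨b, hb, hab⟩
      exact hε a ha b hb hab.symm) hM
  refine ⟨shearedGraph ε h, isIndentedImaginaryAxis_shearedGraph ε hd hT,
    fun p hp => liesLeftOf_shearedGraph ε hbd ?_, fun p hp => liesRightOf_shearedGraph ε hbd ?_⟩
  · by_cases hpM : -M ≤ p.re
    · rw [hhL _ ⟨p, ⟨hp, hpM⟩, rfl⟩]; exact hL p hp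
    · exact (not_le.mp hpM).trans_le (abs_le.mp (hbd _)).1
  · by_cases hpM : p.re ≤ M
    · rw [hhR _ ⟨p, ⟨hp, hpM⟩, rfl⟩]; exact hR p hp
    · exact (abs_le.mp (hbd _)).2.trans_lt (not_le.mp hpM)

/-! ### Growth of Gamma quotients and decay of the integrand -/

theorem not_isNonposInt_iff {s : ℂ} : ¬ IsNonposInt s ↔ ∀ m : ℕ, s ≠ -m := not_exists

theorem not_isNonposInt_of_im_ne_zero {s : ℂ} (hs : s.im ≠ 0) : ¬ IsNonposInt s := by
  rintro ⟨n, rfl⟩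
  simp at hs

theorem not_isNonposInt_of_re_pos {s : ℂ} (hs : 0 < s.re) : ¬ IsNonposInt s := by
  rintro ⟨n, rfl⟩
  have : (0 : ℝ) ≤ n := n.cast_nonneg
  simp at hs
  linarith

theorem Gamma_ne_zero_of_not_isNonposInt {s : ℂ} (hs : ¬ IsNonposInt s) : Gamma s ≠ 0 :=
  Gamma_ne_zero (not_isNonposInt_iff.mp hs)

theorem analyticAt_Gamma_inv (s : ℂ) : AnalyticAt ℂ (fun s => (Gamma s)⁻¹) s :=
  differentiable_one_div_Gamma.analyticAt s

theorem analyticAt_Gamma {s : ℂ} (hs : ¬ IsNonposInt s) : AnalyticAt ℂ Gamma s := by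
  simpa using (analyticAt_Gamma_inv s).fun_inv (inv_ne_zero (Gamma_ne_zero_of_not_isNonposInt hs))

theorem norm_betaIntegral_le_one {u v : ℂ} (hu : 1 ≤ u.re) (hv : 1 ≤ v.re) :
    ‖betaIntegral u v‖ ≤ 1 := by
  unfold betaIntegral
  have h := intervalIntegral.norm_integral_le_of_norm_le_const (a := 0) (b := 1) (C := 1)
    (f := fun x : ℝ => (x : ℂ) ^ (u - 1) * (1 - (x : ℂ)) ^ (v - 1)) (by
      intro x hx
      rw [uIoc_of_le zero_le_one] at hx
      rcases hx.2.eq_or_lt with rfl | hx1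
      · simp only [ofReal_one, one_cpow, one_mul, sub_self]
        by_cases hv1 : v - 1 = 0
        · simp [hv1]
        · simp [zero_cpow hv1]
      · rw [norm_mul, ← ofReal_one, ← ofReal_sub,
          norm_cpow_eq_rpow_re_of_pos hx.1, norm_cpow_eq_rpow_re_of_pos (by linarith)]
        exact mul_le_one₀ (Real.rpow_le_one hx.1.le hx.2 (by simpa using hu))
          (Real.rpow_nonneg (by linarith) _)
          (Real.rpow_le_one (by linarith) (by linarith [hx.1]) (by simpa using hv)))
  simpa using h

/-- The quotient is `B(u, v) / Γ(v)`, and the Beta integrand is bounded by `1`. This takes the place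
of Stirling's formula. -/
theorem norm_Gamma_div_Gamma_add_le {u v : ℂ} (hu : 1 ≤ u.re) (hv : 1 ≤ v.re) :
    ‖Gamma u / Gamma (u + v)‖ ≤ ‖Gamma v‖⁻¹ := by
  have h := betaIntegral_eq_Gamma_mul_div u v (by linarith) (by linarith)
  have hv0 : Gamma v ≠ 0 := Gamma_ne_zero_of_re_pos (by linarith)
  have e : Gamma u / Gamma (u + v) = betaIntegral u v * (Gamma v)⁻¹ := by
    rw [h]; field_simp
  rw [e, norm_mul, norm_inv]
  exact mul_le_of_le_one_left (by positivity) (norm_betaIntegral_le_one hu hv)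

theorem norm_ascPochhammer_le (z : ℂ) (n : ℕ) : ‖(ascPochhammer ℂ n).eval z‖ ≤ (‖z‖ + n) ^ n := by
  induction n with
  | zero => simp
  | succ n ih =>
    rw [ascPochhammer_succ_eval, norm_mul, pow_succ]
    have h1 : ‖z + n‖ ≤ ‖z‖ + (n + 1 : ℕ) := by
      refine (norm_add_le _ _).trans ?_
      simp
    refine mul_le_mul (ih.trans ?_) h1 (norm_nonneg _) (by positivity)
    gcongr
    simp

theorem one_le_norm_ascPochhammer {z : ℂ} (hz : 1 ≤ |z.im|) (n : ℕ) :
    1 ≤ ‖(ascPochhammer ℂ n).eval z‖ := by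
  induction n with
  | zero => simp
  | succ n ih =>
    rw [ascPochhammer_succ_eval, norm_mul]
    refine one_le_mul_of_one_le_of_one_le ih (hz.trans ?_)
    simpa using abs_im_le_norm (z + n)

theorem Gamma_add_nat {z : ℂ} (hz : ¬ IsNonposInt z) (n : ℕ) :
    Gamma (z + n) = (ascPochhammer ℂ n).eval z * Gamma z := by
  rw [← Gamma_add_nat_div_Gamma_eq z (not_isNonposInt_iff.mp hz),
    div_mul_cancel₀ _ (Gamma_ne_zero_of_not_isNonposInt hz)]

/-- Polynomial growth of a quotient of two shifted Gamma functions in a right half-plane, away from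
the poles. -/
theorem exists_norm_Gamma_div_Gamma_le (a f : ℂ) (x₀ : ℝ) : ∃ (C : ℝ) (K : ℕ), 0 ≤ C ∧ ∀ t : ℂ,
    x₀ ≤ t.re → 1 ≤ |(a + t).im| → ‖Gamma (a + t) / Gamma (f + t)‖ ≤ C * (1 + ‖t‖) ^ K := by
  -- The shift `m` brings `re (a + t + m)` above `1`, and `k` makes `re v ≥ 1`, so the Beta bound
  -- applies to the shifted quotient. Undoing the shifts costs a polynomial `(f + t)_k` and a
  -- division by `(a + t)_m`, whose norm is at least `1`.
  obtain ⟨m, hm⟩ := exists_nat_ge (1 - a.re - x₀)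
  obtain ⟨k, hk⟩ := exists_nat_ge (1 - f.re + a.re + m)
  set v : ℂ := f + k - a - m with hv
  have hvre : 1 ≤ v.re := by simp [hv]; linarith
  refine ⟨(1 + ‖f‖ + k) ^ k * ‖Gamma v‖⁻¹, k, by positivity, fun t ht him => ?_⟩
  have hat : ¬ IsNonposInt (a + t) := not_isNonposInt_of_im_ne_zero fun h => by
    rw [h] at him; norm_num at him
  by_cases hft : IsNonposInt (f + t)
  · obtain ⟨j, hj⟩ := hft
    rw [hj, Gamma_neg_nat_eq_zero, div_zero, norm_zero]
    positivity
  have hPm : (ascPochhammer ℂ m).eval (a + t) ≠ 0 := fun h => by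
    have := one_le_norm_ascPochhammer him m
    rw [h] at this; norm_num at this
  have hG : ‖Gamma (a + t + m) / Gamma (f + t + k)‖ ≤ ‖Gamma v‖⁻¹ := by
    have := norm_Gamma_div_Gamma_add_le (u := a + t + m) (v := v) (by simp; linarith) hvre
    rwa [show a + t + m + v = f + t + k by rw [hv]; ring] at this
  have hPk : (ascPochhammer ℂ k).eval (f + t) ≠ 0 := fun h => by
    have h1 := Gamma_add_nat hft k
    rw [h, zero_mul] at h1
    refine Gamma_ne_zero_of_re_pos ?_ h1
    simp; linarith
  have e : Gamma (a + t) / Gamma (f + t) = (ascPochhammer ℂ k).eval (f + t) *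
      (Gamma (a + t + m) / Gamma (f + t + k)) / (ascPochhammer ℂ m).eval (a + t) := by
    rw [Gamma_add_nat hft k, Gamma_add_nat hat m]
    have := Gamma_ne_zero_of_not_isNonposInt hft
    field_simp
  rw [e, norm_div, norm_mul]
  refine (div_le_self (by positivity) (one_le_norm_ascPochhammer him m)).trans ?_
  have h1 : ‖(ascPochhammer ℂ k).eval (f + t)‖ ≤ ((1 + ‖f‖ + k) * (1 + ‖t‖)) ^ k := by
    refine (norm_ascPochhammer_le _ _).trans ?_
    gcongr
    have := norm_add_le f t
    have : 0 ≤ (‖f‖ + k) * ‖t‖ := by positivity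
    nlinarith
  calc _ ≤ ((1 + ‖f‖ + k) * (1 + ‖t‖)) ^ k * ‖Gamma v‖⁻¹ := by gcongr
    _ = _ := by rw [mul_pow]; ring

theorem exp_abs_im_le_norm_sin {z : ℂ} (hz : 1 ≤ |z.im|) : Real.exp |z.im| / 4 ≤ ‖sin z‖ := by
  have h1 : ‖exp (z * I)‖ = Real.exp (-z.im) := by rw [norm_exp]; simp
  have h2 : ‖exp (-z * I)‖ = Real.exp z.im := by rw [norm_exp]; simp
  have h3 : ‖sin z‖ = ‖exp (-z * I) - exp (z * I)‖ / 2 := by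
    rw [sin, norm_div, norm_mul, norm_I, mul_one]; simp
  have h4 : Real.exp |z.im| - Real.exp (-|z.im|) ≤ ‖exp (-z * I) - exp (z * I)‖ := by
    rcases abs_cases z.im with ⟨h, -⟩ | ⟨h, -⟩
    · rw [h, ← h1, ← h2]; exact norm_sub_norm_le _ _
    · rw [h, neg_neg, ← h1, ← h2, norm_sub_rev]; exact norm_sub_norm_le _ _
  have h5 : Real.exp (-|z.im|) ≤ 1 := Real.exp_le_one_iff.mpr (by linarith)
  have h6 : 2 ≤ Real.exp |z.im| := by
    have := Real.add_one_le_exp |z.im|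
    linarith
  rw [h3]
  linarith

theorem Gamma_neg_eq {t : ℂ} (ht : ¬ IsNonposInt (1 + t)) :
    Gamma (-t) = -(Real.pi / sin (Real.pi * t)) * (Gamma (1 + t))⁻¹ := by
  have h := Gamma_mul_Gamma_one_sub (-t)
  have h0 := Gamma_ne_zero_of_not_isNonposInt ht
  rw [sub_neg_eq_add, mul_neg, sin_neg, div_neg] at h
  rw [← h]
  field_simp

theorem Gamma_one_sub_sub_eq {e t : ℂ} (ht : ¬ IsNonposInt (e + t)) :
    Gamma (1 - e - t) = (Real.pi / sin (Real.pi * (e + t))) * (Gamma (e + t))⁻¹ := by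
  have h := Gamma_mul_Gamma_one_sub (e + t)
  have h0 := Gamma_ne_zero_of_not_isNonposInt ht
  rw [← h, sub_add_eq_sub_sub]
  field_simp

theorem pow_mul_exp_neg_le (K : ℕ) {y : ℝ} (hy : 0 < y) :
    (1 + y) ^ K * Real.exp (-y) ≤ (K + 2).factorial * Real.exp 1 / y ^ 2 := by
  have h := Real.pow_div_factorial_le_exp (1 + y) (by linarith) (K + 2)
  rw [div_le_iff₀ (by positivity), Real.exp_add] at h
  rw [le_div_iff₀ (by positivity)]
  calc (1 + y) ^ K * Real.exp (-y) * y ^ 2 ≤ (1 + y) ^ K * Real.exp (-y) * (1 + y) ^ 2 := by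
        gcongr; linarith
    _ = (1 + y) ^ (K + 2) * Real.exp (-y) := by ring
    _ ≤ (Real.exp 1 * Real.exp y * (K + 2).factorial) * Real.exp (-y) := by gcongr
    _ = (K + 2).factorial * Real.exp 1 * (Real.exp y * Real.exp (-y)) := by ring
    _ = _ := by rw [← Real.exp_add]; simp

/-- The product of the two factors of the Barnes integrand, with the reflection formula applied to
the factors of the form `Γ(b_j - t)`. -/
theorem barnes_eq_sin_form {a b c d e f g t : ℂ} (h1 : ¬ IsNonposInt (1 + t))
    (h2 : ¬ IsNonposInt (e + t)) :
    barnesLeftFactor a b c d f g t * barnesRightFactor e t =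
      -(Real.pi / sin (Real.pi * (e + t)) * (Real.pi / sin (Real.pi * t))) *
        (Gamma (a + t) / Gamma (f + t) * (Gamma (b + t) / Gamma (g + t)) *
          (Gamma (c + t) / Gamma (e + t)) * (Gamma (d + t) / Gamma (1 + t))) := by
  rw [barnesLeftFactor, barnesRightFactor, Gamma_neg_eq h1, Gamma_one_sub_sub_eq h2]
  simp only [div_eq_mul_inv, mul_inv]
  ring

/-- The true rate of decay is `exp (-π |im t|)`; the weaker `exp (-|im t|)` already beats every
power. -/
theorem norm_pi_div_sin_le {e t : ℂ} (h : |e.im| + 1 ≤ |t.im|) :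
    ‖(Real.pi / sin (Real.pi * (e + t)) : ℂ)‖ ≤
      4 * Real.pi * Real.exp (Real.pi * |e.im|) * Real.exp (-|t.im|) := by
  have hpi := Real.pi_gt_three
  have him : (Real.pi * (e + t) : ℂ).im = Real.pi * (e.im + t.im) := by simp
  have h1 : |t.im| - |e.im| ≤ |e.im + t.im| := by
    have := abs_sub_abs_le_abs_sub t.im (-e.im)
    rw [abs_neg, sub_neg_eq_add, add_comm t.im] at this
    exact this
  have h2 : Real.pi * (|t.im| - |e.im|) ≤ |(Real.pi * (e + t) : ℂ).im| := by
    rw [him, abs_mul, abs_of_pos Real.pi_pos]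
    gcongr
  have h3 := exp_abs_im_le_norm_sin (z := Real.pi * (e + t)) (by nlinarith)
  have h4 : Real.exp (|t.im| - Real.pi * |e.im|) ≤ Real.exp |(Real.pi * (e + t) : ℂ).im| := by
    apply Real.exp_le_exp.mpr
    have := abs_nonneg t.im
    nlinarith
  have h5 : Real.exp (|t.im| - Real.pi * |e.im|) / 4 ≤ ‖sin (Real.pi * (e + t))‖ := by linarith
  rw [norm_div, norm_real, Real.norm_of_nonneg Real.pi_pos.le]
  refine (div_le_div_of_nonneg_left Real.pi_pos.le (by positivity) h5).trans (le_of_eq ?_)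
  rw [Real.exp_sub, Real.exp_neg]
  have := Real.exp_ne_zero |t.im|
  have := Real.exp_ne_zero (Real.pi * |e.im|)
  field_simp

theorem exists_norm_barnes_le (a b c d e f g : ℂ) (x₀ x₁ : ℝ) : ∃ C T : ℝ, ∀ t : ℂ,
    t.re ∈ Icc x₀ x₁ → T ≤ |t.im| →
    ‖barnesLeftFactor a b c d f g t * barnesRightFactor e t‖ ≤ C / t.im ^ 2 := by
  obtain ⟨C1, K1, hC1, h1⟩ := exists_norm_Gamma_div_Gamma_le a f x₀
  obtain ⟨C2, K2, hC2, h2⟩ := exists_norm_Gamma_div_Gamma_le b g x₀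
  obtain ⟨C3, K3, hC3, h3⟩ := exists_norm_Gamma_div_Gamma_le c e x₀
  obtain ⟨C4, K4, hC4, h4⟩ := exists_norm_Gamma_div_Gamma_le d 1 x₀
  set X := 1 + |x₀| + |x₁| with hX
  set E := 4 * Real.pi * Real.exp (Real.pi * |e.im|)
  set E0 := 4 * Real.pi * Real.exp (Real.pi * |(0 : ℂ).im|)
  set K := K1 + K2 + K3 + K4 with hK
  refine ⟨E * E0 * (C1 * C2 * C3 * C4) * X ^ K * ((K + 2).factorial * Real.exp 1),
    1 + |a.im| + |b.im| + |c.im| + |d.im| + |e.im|, fun t ht hT => ?_⟩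
  have ha0 := abs_nonneg a.im
  have hb0 := abs_nonneg b.im
  have hc0 := abs_nonneg c.im
  have hd0 := abs_nonneg d.im
  have he0 := abs_nonneg e.im
  have hp : ∀ s : ℂ, |s.im| + 1 ≤ |t.im| → 1 ≤ |(s + t).im| := fun s hs => by
    have := abs_sub_abs_le_abs_sub t.im (-s.im)
    rw [abs_neg, sub_neg_eq_add, add_comm t.im] at this
    rw [add_im]; linarith
  have hne : ∀ s : ℂ, |s.im| + 1 ≤ |t.im| → ¬ IsNonposInt (s + t) := fun s hs =>
    not_isNonposInt_of_im_ne_zero fun h => by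
      have := hp s hs
      rw [h] at this; norm_num at this
  have hy : 0 < |t.im| := by linarith
  rw [barnes_eq_sin_form (hne 1 (by simp; linarith)) (hne e (by linarith))]
  rw [norm_mul, norm_neg, norm_mul, norm_mul, norm_mul, norm_mul]
  have s1 := norm_pi_div_sin_le (e := e) (t := t) (by linarith)
  have s2 := norm_pi_div_sin_le (e := 0) (t := t) (by simp; linarith)
  rw [zero_add] at s2
  have hn : 1 + ‖t‖ ≤ X * (1 + |t.im|) := by
    have h := norm_le_abs_re_add_abs_im t
    have hre : |t.re| ≤ |x₀| + |x₁| := by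
      rw [abs_le]
      have := neg_abs_le x₀
      have := le_abs_self x₁
      have := abs_nonneg x₀
      have := abs_nonneg x₁
      constructor <;> linarith [ht.1, ht.2]
    have : 0 ≤ (|x₀| + |x₁|) * |t.im| := by positivity
    rw [hX]
    nlinarith
  have g1 := h1 t ht.1 (hp a (by linarith))
  have g2 := h2 t ht.1 (hp b (by linarith))
  have g3 := h3 t ht.1 (hp c (by linarith))
  have g4 := h4 t ht.1 (hp d (by linarith))
  have hE : 0 ≤ E := by positivity
  have hE0 : 0 ≤ E0 := by positivity
  -- Four polynomially bounded quotients against two exponentials. One exponential is discarded as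
  -- at most `1`; the other absorbs the power of `1 + |im t|`.
  calc _ ≤ E * Real.exp (-|t.im|) * (E0 * Real.exp (-|t.im|)) *
        (C1 * (1 + ‖t‖) ^ K1 * (C2 * (1 + ‖t‖) ^ K2) * (C3 * (1 + ‖t‖) ^ K3) *
          (C4 * (1 + ‖t‖) ^ K4)) := by gcongr
    _ = E * E0 * (C1 * C2 * C3 * C4) * ((1 + ‖t‖) ^ K * Real.exp (-|t.im|) * Real.exp (-|t.im|)) := by
        rw [hK]; ring
    _ ≤ E * E0 * (C1 * C2 * C3 * C4) * ((X * (1 + |t.im|)) ^ K * Real.exp (-|t.im|) * 1) := by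
        gcongr
        exact Real.exp_le_one_iff.mpr (by linarith)
    _ = E * E0 * (C1 * C2 * C3 * C4) * X ^ K * ((1 + |t.im|) ^ K * Real.exp (-|t.im|)) := by
        rw [mul_pow]; ring
    _ ≤ E * E0 * (C1 * C2 * C3 * C4) * X ^ K * ((K + 2).factorial * Real.exp 1 / |t.im| ^ 2) := by
        gcongr
        exact pow_mul_exp_neg_le K hy
    _ = _ := by rw [sq_abs]; ring

/-! ### Pochhammer quotients with parameter excess two -/

/-- The quotient of Pochhammer symbols `∏ (p_i)_n / ∏ (q_i)_n`. -/
noncomputable def pochhammerRatio (p q : Fin 4 → ℂ) (n : ℕ) : ℂ :=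
  ∏ i, (ascPochhammer ℂ n).eval (p i) / (ascPochhammer ℂ n).eval (q i)

/-- Euler's sequence for `Γ` at index `n` has `n + 1` linear factors in its denominator, whence the
index `n + 1` here. -/
theorem ascPochhammer_succ_eq_GammaSeq (s : ℂ) {n : ℕ} (hn : n ≠ 0) :
    (ascPochhammer ℂ (n + 1)).eval s = (n : ℂ) ^ s * n.factorial * (GammaSeq s n)⁻¹ := by
  have h : (ascPochhammer ℂ (n + 1)).eval s = ∏ j ∈ Finset.range (n + 1), (s + j) := by
    induction n + 1 with
    | zero => simp
    | succ k ih => rw [ascPochhammer_succ_eval, ih, Finset.prod_range_succ]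
  rw [h, GammaSeq, inv_div]
  have : (n : ℂ) ^ s ≠ 0 := by simp [cpow_eq_zero_iff, hn]
  have : (n.factorial : ℂ) ≠ 0 := by exact_mod_cast n.factorial_ne_zero
  field_simp

/-- In Euler's limit the factorials cancel and the powers combine to `n ^ (∑ p - ∑ q) = n⁻²`. -/
theorem tendsto_pochhammerRatio {p q : Fin 4 → ℂ} (hp : ∀ i, ¬ IsNonposInt (p i))
    (hpq : ∑ i, q i - ∑ i, p i = 2) :
    Tendsto (fun n : ℕ => (n : ℂ) ^ 2 * pochhammerRatio p q (n + 1)) atTop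
      (𝓝 (∏ i, (Gamma (p i))⁻¹ * Gamma (q i))) := by
  have h := tendsto_finsetProd (Finset.univ : Finset (Fin 4)) fun i _ =>
    ((GammaSeq_tendsto_Gamma (p i)).inv₀ (Gamma_ne_zero_of_not_isNonposInt (hp i))).mul
      (GammaSeq_tendsto_Gamma (q i))
  refine h.congr' ?_
  filter_upwards [eventually_ne_atTop 0] with n hn
  have hn' : (n : ℂ) ≠ 0 := Nat.cast_ne_zero.mpr hn
  have hf : (n.factorial : ℂ) ≠ 0 := by exact_mod_cast n.factorial_ne_zero
  have e : ∀ i, (ascPochhammer ℂ (n + 1)).eval (p i) / (ascPochhammer ℂ (n + 1)).eval (q i) =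
      (n : ℂ) ^ (p i - q i) * ((GammaSeq (p i) n)⁻¹ * GammaSeq (q i) n) := fun i => by
    rw [ascPochhammer_succ_eq_GammaSeq _ hn, ascPochhammer_succ_eq_GammaSeq _ hn, cpow_sub _ _ hn']
    have : (n : ℂ) ^ q i ≠ 0 := by simp [cpow_eq_zero_iff, hn]
    simp only [div_eq_mul_inv, mul_inv, inv_inv]
    field_simp
  have e2 : ∏ i, (n : ℂ) ^ (p i - q i) = ((n : ℂ) ^ 2)⁻¹ := by
    have : ∑ i, (p i - q i) = -2 := by rw [Finset.sum_sub_distrib]; linear_combination -hpq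
    rw [Fin.sum_univ_four] at this
    rw [Fin.prod_univ_four, ← cpow_add _ _ hn', ← cpow_add _ _ hn', ← cpow_add _ _ hn', this,
      cpow_neg]
    norm_cast
  rw [pochhammerRatio, Finset.prod_congr rfl fun i _ => e i,
    Finset.prod_mul_distrib (f := fun i => (n : ℂ) ^ (p i - q i)), e2]
  field_simp

theorem summable_pochhammerRatio {p q : Fin 4 → ℂ} (hp : ∀ i, ¬ IsNonposInt (p i))
    (hpq : ∑ i, q i - ∑ i, p i = 2) : Summable (pochhammerRatio p q) := by
  rw [← summable_nat_add_iff 1]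
  refine summable_of_isBigO_nat (Real.summable_one_div_nat_pow.mpr one_lt_two) ?_
  obtain ⟨C, hC⟩ := ((tendsto_pochhammerRatio hp hpq).isBigO_one ℝ).bound
  refine Asymptotics.IsBigO.of_bound C ?_
  filter_upwards [hC, eventually_ne_atTop 0] with n h hn
  have hn' : 0 < (n : ℝ) ^ 2 := by positivity
  rw [norm_mul, norm_one, mul_one, norm_pow, norm_natCast] at h
  rw [Real.norm_of_nonneg (by positivity), mul_one_div, le_div_iff₀ hn']
  linarith

theorem tendsto_pochhammerRatio_zero {p q : Fin 4 → ℂ} (hp : ∀ i, ¬ IsNonposInt (p i))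
    (hpq : ∑ i, q i - ∑ i, p i = 2) : Tendsto (pochhammerRatio p q) atTop (𝓝 0) :=
  (summable_pochhammerRatio hp hpq).tendsto_atTop_zero

/-- The terms left over have degree at least two in the `Aᵢ`, so each is of size at most a constant
times `s ^ 6`. It is applied with `s = ‖t‖` and `s ^ 2 + Aᵢ = ‖pᵢ + t‖ ^ 2`. -/
theorem abs_prod_sub_le {s M : ℝ} (hs : 1 ≤ s) {A₁ A₂ A₃ A₄ : ℝ} (h₁ : |A₁| ≤ M * s)
    (h₂ : |A₂| ≤ M * s) (h₃ : |A₃| ≤ M * s) (h₄ : |A₄| ≤ M * s) :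
    |(s ^ 2 + A₁) * (s ^ 2 + A₂) * (s ^ 2 + A₃) * (s ^ 2 + A₄) - s ^ 8
      - s ^ 6 * (A₁ + A₂ + A₃ + A₄)| ≤ (6 * M ^ 2 + 4 * M ^ 3 + M ^ 4) * s ^ 6 := by
  have hM : 0 ≤ M * s := (abs_nonneg _).trans h₁
  have hM0 : 0 ≤ M := nonneg_of_mul_nonneg_left hM (by linarith)
  have two : ∀ {x y : ℝ}, |x| ≤ M * s → |y| ≤ M * s → |x * y| ≤ M ^ 2 * s ^ 2 := fun hx hy => by
    rw [abs_mul, ← mul_pow, sq]; exact mul_le_mul hx hy (abs_nonneg _) hM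
  have three : ∀ {x y z : ℝ}, |x| ≤ M * s → |y| ≤ M * s → |z| ≤ M * s →
      |x * y * z| ≤ M ^ 3 * s ^ 3 := fun hx hy hz => by
    rw [abs_mul]
    calc _ ≤ M ^ 2 * s ^ 2 * (M * s) := mul_le_mul (two hx hy) hz (abs_nonneg _) (by positivity)
      _ = _ := by ring
  have e2 : |s ^ 4 * (A₁ * A₂ + A₁ * A₃ + A₁ * A₄ + A₂ * A₃ + A₂ * A₄ + A₃ * A₄)| ≤
      6 * M ^ 2 * s ^ 6 := by
    rw [abs_mul, abs_of_nonneg (by positivity)]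
    have : |A₁ * A₂ + A₁ * A₃ + A₁ * A₄ + A₂ * A₃ + A₂ * A₄ + A₃ * A₄| ≤ 6 * (M ^ 2 * s ^ 2) := by
      have a := abs_le.mp (two h₁ h₂)
      have b := abs_le.mp (two h₁ h₃)
      have c := abs_le.mp (two h₁ h₄)
      have d := abs_le.mp (two h₂ h₃)
      have e := abs_le.mp (two h₂ h₄)
      have f := abs_le.mp (two h₃ h₄)
      rw [abs_le]
      constructor <;> linarith
    calc _ ≤ s ^ 4 * (6 * (M ^ 2 * s ^ 2)) := by gcongr
      _ = _ := by ring
  have e3 : |s ^ 2 * (A₁ * A₂ * A₃ + A₁ * A₂ * A₄ + A₁ * A₃ * A₄ + A₂ * A₃ * A₄)| ≤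
      4 * M ^ 3 * s ^ 6 := by
    rw [abs_mul, abs_of_nonneg (by positivity)]
    have : |A₁ * A₂ * A₃ + A₁ * A₂ * A₄ + A₁ * A₃ * A₄ + A₂ * A₃ * A₄| ≤ 4 * (M ^ 3 * s ^ 3) := by
      have a := abs_le.mp (three h₁ h₂ h₃)
      have b := abs_le.mp (three h₁ h₂ h₄)
      have c := abs_le.mp (three h₁ h₃ h₄)
      have d := abs_le.mp (three h₂ h₃ h₄)
      rw [abs_le]
      constructor <;> linarith
    calc _ ≤ s ^ 2 * (4 * (M ^ 3 * s ^ 3)) := by gcongr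
      _ = 4 * M ^ 3 * s ^ 5 := by ring
      _ ≤ _ := by gcongr; norm_num
  have e4 : |A₁ * A₂ * A₃ * A₄| ≤ M ^ 4 * s ^ 6 := by
    rw [abs_mul]
    calc _ ≤ M ^ 3 * s ^ 3 * (M * s) :=
          mul_le_mul (three h₁ h₂ h₃) h₄ (abs_nonneg _) (by positivity)
      _ = M ^ 4 * s ^ 4 := by ring
      _ ≤ _ := by gcongr; norm_num
  rw [abs_le] at e2 e3 e4 ⊢
  constructor <;> linarith

theorem norm_add_sq_eq (p t : ℂ) :
    ‖p + t‖ ^ 2 = ‖t‖ ^ 2 + (2 * (p.re * t.re + p.im * t.im) + ‖p‖ ^ 2) := by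
  rw [Complex.sq_norm, Complex.sq_norm, Complex.sq_norm, normSq_apply, normSq_apply, normSq_apply,
    add_re, add_im]
  ring

theorem abs_norm_add_sq_sub_le (p : ℂ) {t : ℂ} (ht : 1 ≤ ‖t‖) :
    |2 * (p.re * t.re + p.im * t.im) + ‖p‖ ^ 2| ≤ (2 * ‖p‖ + ‖p‖ ^ 2) * ‖t‖ := by
  have h : |p.re * t.re + p.im * t.im| ≤ ‖p‖ * ‖t‖ := by
    have := abs_re_le_norm (p * (starRingEnd ℂ) t)
    rw [norm_mul, norm_conj] at this
    simpa using this
  rw [abs_le] at h ⊢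
  have : ‖p‖ ^ 2 ≤ ‖p‖ ^ 2 * ‖t‖ := le_mul_of_one_le_right (by positivity) ht
  have : 0 ≤ ‖p‖ ^ 2 := by positivity
  constructor <;> nlinarith

/-- If `∑ q_i - ∑ p_i = 2`, then `|∏ (p_i + t)| ≤ |∏ (q_i + t)|` far to the right. -/
theorem exists_norm_prod_add_le (p q : Fin 4 → ℂ) (hpq : ∑ i, q i - ∑ i, p i = 2) :
    ∃ x₀ : ℝ, ∀ t : ℂ, x₀ ≤ t.re → ‖∏ i, (p i + t)‖ ≤ ‖∏ i, (q i + t)‖ := by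
  set M : ℝ := ∑ i, (2 * ‖p i‖ + ‖p i‖ ^ 2) + ∑ i, (2 * ‖q i‖ + ‖q i‖ ^ 2) with hM
  set K : ℝ := 6 * M ^ 2 + 4 * M ^ 3 + M ^ 4 with hK
  -- To first order the squared products differ by `‖t‖ ^ 6 (4 re t + ∑ ‖q i‖² - ∑ ‖p i‖²)`; there
  -- is no `im t` term because `∑ q - ∑ p` is real. The two error terms cost at most `2 K ‖t‖ ^ 6`,
  -- so a bound on `re t` alone suffices.
  refine ⟨max 1 (∑ i, ‖p i‖ ^ 2 + 2 * K), fun t ht => ?_⟩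
  have ht1 : 1 ≤ ‖t‖ := ((le_max_left _ _).trans ht).trans (re_le_norm t)
  have ht2 : ∑ i, ‖p i‖ ^ 2 + 2 * K ≤ t.re := (le_max_right _ _).trans ht
  have ht0 : 0 < t.re := lt_of_lt_of_le one_pos ((le_max_left _ _).trans ht)
  have hnn : ∀ r : Fin 4 → ℂ, ∀ i ∈ Finset.univ, 0 ≤ 2 * ‖r i‖ + ‖r i‖ ^ 2 :=
    fun r i _ => by positivity
  have hMp : ∀ i, |2 * ((p i).re * t.re + (p i).im * t.im) + ‖p i‖ ^ 2| ≤ M * ‖t‖ := fun i => by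
    refine (abs_norm_add_sq_sub_le (p i) ht1).trans ?_
    gcongr
    have := Finset.single_le_sum (hnn p) (Finset.mem_univ i)
    have := Finset.sum_nonneg (hnn q)
    linarith
  have hMq : ∀ i, |2 * ((q i).re * t.re + (q i).im * t.im) + ‖q i‖ ^ 2| ≤ M * ‖t‖ := fun i => by
    refine (abs_norm_add_sq_sub_le (q i) ht1).trans ?_
    gcongr
    have := Finset.single_le_sum (hnn q) (Finset.mem_univ i)
    have := Finset.sum_nonneg (hnn p)
    linarith
  have hP := abs_le.mp (abs_prod_sub_le ht1 (hMp 0) (hMp 1) (hMp 2) (hMp 3))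
  have hQ := abs_le.mp (abs_prod_sub_le ht1 (hMq 0) (hMq 1) (hMq 2) (hMq 3))
  simp only [← norm_add_sq_eq] at hP hQ
  have hre : ∑ i, (q i).re - ∑ i, (p i).re = 2 := by
    rw [← re_sum, ← re_sum, ← sub_re, hpq]; rfl
  have him : ∑ i, (q i).im - ∑ i, (p i).im = 0 := by
    rw [← im_sum, ← im_sum, ← sub_im, hpq]; rfl
  refine le_of_sq_le_sq ?_ (norm_nonneg _)
  rw [norm_prod, norm_prod, ← Finset.prod_pow, ← Finset.prod_pow]
  simp only [Fin.sum_univ_four, Fin.prod_univ_four] at *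
  have hs6 : 0 < ‖t‖ ^ 6 := by positivity
  have key : ‖t‖ ^ 6 * (‖p 0‖ ^ 2 + ‖p 1‖ ^ 2 + ‖p 2‖ ^ 2 + ‖p 3‖ ^ 2 + 2 * K) ≤
      ‖t‖ ^ 6 * (t.re) := by gcongr
  have hq2 : 0 ≤ ‖t‖ ^ 6 * (‖q 0‖ ^ 2 + ‖q 1‖ ^ 2 + ‖q 2‖ ^ 2 + ‖q 3‖ ^ 2) := by positivity
  have h6 : 0 < ‖t‖ ^ 6 * t.re := by positivity
  have hre' := congrArg (fun r => ‖t‖ ^ 6 * (2 * r * t.re)) hre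
  have him' := congrArg (fun r => ‖t‖ ^ 6 * (2 * r * t.im)) him
  linarith [hP.2, hQ.1]

/-! ### Poles of the two factors and existence of the contour -/

theorem analyticAt_barnesLeftFactor {a b c d t : ℂ} (f g : ℂ) (ha : ¬ IsNonposInt (a + t))
    (hb : ¬ IsNonposInt (b + t)) (hc : ¬ IsNonposInt (c + t)) (hd : ¬ IsNonposInt (d + t)) :
    AnalyticAt ℂ (barnesLeftFactor a b c d f g) t := by
  have hadd : ∀ s : ℂ, AnalyticAt ℂ (fun t => s + t) t := fun s => by fun_prop
  have hG : ∀ s : ℂ, ¬ IsNonposInt (s + t) → AnalyticAt ℂ (fun t => Gamma (s + t)) t :=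
    fun s hs => (analyticAt_Gamma hs).fun_comp (hadd s)
  have hI : ∀ s : ℂ, AnalyticAt ℂ (fun t => (Gamma (s + t))⁻¹) t :=
    fun s => (analyticAt_Gamma_inv (s + t)).fun_comp (hadd s)
  have e : barnesLeftFactor a b c d f g = fun t => Gamma (a + t) * Gamma (b + t) * Gamma (c + t) *
      Gamma (d + t) * ((Gamma (f + t))⁻¹ * (Gamma (g + t))⁻¹) := by
    ext t; rw [barnesLeftFactor, div_eq_mul_inv, mul_inv]
  rw [e]
  exact ((((hG a ha).fun_mul (hG b hb)).fun_mul (hG c hc)).fun_mul (hG d hd)).fun_mul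
    ((hI f).fun_mul (hI g))

theorem analyticAt_barnesRightFactor {e t : ℂ} (he : ¬ IsNonposInt (1 - e - t))
    (h0 : ¬ IsNonposInt (-t)) : AnalyticAt ℂ (barnesRightFactor e) t :=
  AnalyticAt.fun_mul ((analyticAt_Gamma he).fun_comp (by fun_prop : AnalyticAt ℂ (fun t => 1 - e - t) t))
    ((analyticAt_Gamma h0).fun_comp (by fun_prop : AnalyticAt ℂ (fun t => -t) t))

theorem meromorphic_barnesLeftFactor (a b c d f g : ℂ) :
    Meromorphic (barnesLeftFactor a b c d f g) := by
  intro t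
  have hG : ∀ s : ℂ, MeromorphicAt (fun t => Gamma (s + t)) t := fun s =>
    (Meromorphic.Gamma (s + t)).comp_analyticAt (by fun_prop : AnalyticAt ℂ (fun t => s + t) t)
  exact ((((hG a).mul (hG b)).mul (hG c)).mul (hG d)).div ((hG f).mul (hG g))

theorem meromorphic_barnesRightFactor (e : ℂ) : Meromorphic (barnesRightFactor e) := fun t =>
  ((Meromorphic.Gamma (1 - e - t)).comp_analyticAt
      (by fun_prop : AnalyticAt ℂ (fun t => 1 - e - t) t)).mul
    ((Meromorphic.Gamma (-t)).comp_analyticAt (by fun_prop : AnalyticAt ℂ (fun t => -t) t))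

theorem AnalyticAt.not_hasPoleAt {F : ℂ → ℂ} {p : ℂ} (h : AnalyticAt ℂ F p) : ¬ HasPoleAt F p :=
  not_lt.mpr h.meromorphicOrderAt_nonneg

theorem HasPoleAt.barnesLeftFactor {a b c d f g p : ℂ}
    (h : HasPoleAt (barnesLeftFactor a b c d f g) p) :
    IsNonposInt (a + p) ∨ IsNonposInt (b + p) ∨ IsNonposInt (c + p) ∨ IsNonposInt (d + p) := by
  by_contra! hcon
  exact (analyticAt_barnesLeftFactor f g hcon.1 hcon.2.1 hcon.2.2.1 hcon.2.2.2).not_hasPoleAt h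

theorem HasPoleAt.barnesRightFactor {e p : ℂ} (h : HasPoleAt (barnesRightFactor e) p) :
    IsNonposInt (1 - e - p) ∨ IsNonposInt (-p) := by
  by_contra! hcon
  exact (analyticAt_barnesRightFactor hcon.1 hcon.2).not_hasPoleAt h

theorem hasPoleAt_of_tendsto {F : ℂ → ℂ} {p r : ℂ} (hF : MeromorphicAt F p) (hr : r ≠ 0)
    (h : Tendsto (fun t => (t - p) * F t) (𝓝[≠] p) (𝓝 r)) : HasPoleAt F p := by
  by_contra hcon
  obtain ⟨c, hc⟩ := (tendsto_nhds_iff_meromorphicOrderAt_nonneg hF).mpr (not_lt.mp hcon)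
  have h0 : Tendsto (fun t : ℂ => t - p) (𝓝[≠] p) (𝓝 0) := by
    have : Tendsto (fun t : ℂ => t - p) (𝓝 p) (𝓝 (p - p)) := tendsto_id.sub_const p
    rw [sub_self] at this
    exact this.mono_left nhdsWithin_le_nhds
  have := tendsto_nhds_unique h (h0.mul hc)
  exact hr (by simpa using this)

theorem finite_setOf_isNonposInt_add (s : ℂ) (x : ℝ) : {p : ℂ | IsNonposInt (s + p) ∧ x ≤ p.re}.Finite := by
  obtain ⟨N, hN⟩ := exists_nat_ge (-s.re - x)
  refine ((Set.finite_le_nat N).image fun n : ℕ => -s - (n : ℂ)).subset ?_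
  rintro p ⟨⟨n, hn⟩, hx⟩
  refine ⟨n, ?_, by linear_combination -hn⟩
  have := congrArg re hn
  simp at this
  rw [mem_ofPred]
  exact_mod_cast (by linarith : (n : ℝ) ≤ N)

theorem finite_setOf_isNonposInt_sub (s : ℂ) (x : ℝ) : {p : ℂ | IsNonposInt (s - p) ∧ p.re ≤ x}.Finite := by
  obtain ⟨N, hN⟩ := exists_nat_ge (x - s.re)
  refine ((Set.finite_le_nat N).image fun n : ℕ => s + (n : ℂ)).subset ?_
  rintro p ⟨⟨n, hn⟩, hx⟩
  refine ⟨n, ?_, by linear_combination hn⟩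
  have := congrArg re hn
  simp at this
  rw [mem_ofPred]
  exact_mod_cast (by linarith : (n : ℝ) ≤ N)

theorem finite_poles_barnesLeftFactor (a b c d f g : ℂ) (x : ℝ) :
    {p : ℂ | HasPoleAt (barnesLeftFactor a b c d f g) p ∧ x ≤ p.re}.Finite := by
  refine ((finite_setOf_isNonposInt_add a x).union ((finite_setOf_isNonposInt_add b x).union
    ((finite_setOf_isNonposInt_add c x).union (finite_setOf_isNonposInt_add d x)))).subset ?_
  rintro p ⟨hp, hx⟩
  rcases hp.barnesLeftFactor with h | h | h | h
  exacts [Or.inl ⟨h, hx⟩, Or.inr (Or.inl ⟨h, hx⟩), Or.inr (Or.inr (Or.inl ⟨h, hx⟩)),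
    Or.inr (Or.inr (Or.inr ⟨h, hx⟩))]

theorem finite_poles_barnesRightFactor (e : ℂ) (x : ℝ) :
    {p : ℂ | HasPoleAt (barnesRightFactor e) p ∧ p.re ≤ x}.Finite := by
  refine ((finite_setOf_isNonposInt_sub (1 - e) x).union (finite_setOf_isNonposInt_sub 0 x)).subset ?_
  rintro p ⟨hp, hx⟩
  rcases hp.barnesRightFactor with h | h
  exacts [Or.inl ⟨h, hx⟩, Or.inr ⟨by rwa [zero_sub], hx⟩]

theorem IsNonposInt.re_le {s p : ℂ} (h : IsNonposInt (s + p)) : p.re ≤ -s.re := by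
  obtain ⟨n, hn⟩ := h
  have := congrArg re hn
  have h0 : (0 : ℝ) ≤ n := n.cast_nonneg
  simp at this
  linarith

theorem HasPoleAt.re_le_of_barnesLeftFactor {a b c d f g p : ℂ}
    (h : HasPoleAt (_root_.barnesLeftFactor a b c d f g) p) :
    p.re ≤ |a.re| + |b.re| + |c.re| + |d.re| := by
  have := neg_abs_le a.re
  have := neg_abs_le b.re
  have := neg_abs_le c.re
  have := neg_abs_le d.re
  have := abs_nonneg a.re
  have := abs_nonneg b.re
  have := abs_nonneg c.re
  have := abs_nonneg d.re
  rcases h.barnesLeftFactor with h | h | h | h <;> have := h.re_le <;> linarith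

theorem HasPoleAt.le_re_of_barnesRightFactor {e p : ℂ}
    (h : HasPoleAt (_root_.barnesRightFactor e) p) : -|e.re| ≤ p.re := by
  have h1 := le_abs_self e.re
  have h2 := abs_nonneg e.re
  rcases h.barnesRightFactor with ⟨n, hn⟩ | ⟨n, hn⟩ <;>
  · have := congrArg re hn
    have h0 : (0 : ℝ) ≤ n := n.cast_nonneg
    simp at this
    linarith

theorem IsNonposInt.of_add_natCast {s : ℂ} {n : ℕ} (h : IsNonposInt (s + n)) : IsNonposInt s := by
  obtain ⟨m, hm⟩ := h
  exact ⟨m + n, by push_cast; linear_combination hm⟩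

theorem not_isNonposInt_add_natCast_of_forall_int {e : ℂ} (he : ∀ n : ℤ, e ≠ n) (n : ℕ) :
    ¬ IsNonposInt (e + n) := fun h => by
  obtain ⟨m, hm⟩ := h.of_add_natCast
  exact he (-m) (by simpa using hm)

theorem not_isNonposInt_two_sub {e : ℂ} (he : ∀ n : ℤ, e ≠ n) (n : ℕ) :
    ¬ IsNonposInt (2 - e + n) := fun h => by
  obtain ⟨m, hm⟩ := h.of_add_natCast
  exact he (m + 2) (by push_cast; linear_combination -hm)

theorem sin_pi_mul_ne_zero_of_forall_int {e : ℂ} (he : ∀ n : ℤ, e ≠ n) : sin (Real.pi * e) ≠ 0 := by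
  rw [Ne, sin_eq_zero_iff]
  rintro ⟨k, hk⟩
  have hpi : (Real.pi : ℂ) ≠ 0 := ofReal_ne_zero.mpr Real.pi_ne_zero
  exact he k (mul_left_cancel₀ hpi (by linear_combination hk))

theorem exists_contour {a b c d e f g : ℂ} (ha : ¬ IsNonposInt a) (hb : ¬ IsNonposInt b)
    (hc : ¬ IsNonposInt c) (hd : ¬ IsNonposInt d)
    (hae : ¬ IsNonposInt (1 + a - e)) (hbe : ¬ IsNonposInt (1 + b - e))
    (hce : ¬ IsNonposInt (1 + c - e)) (hde : ¬ IsNonposInt (1 + d - e)) :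
    ∃ γ : ℝ → ℂ, IsBarnesContour (barnesLeftFactor a b c d f g) (barnesRightFactor e) γ := by
  set M : ℝ := |a.re| + |b.re| + |c.re| + |d.re| + |e.re| + 1 with hM
  have := abs_nonneg a.re
  have := abs_nonneg b.re
  have := abs_nonneg c.re
  have := abs_nonneg d.re
  have := abs_nonneg e.re
  obtain ⟨γ, h1, h2, h3⟩ := exists_indentedImaginaryAxis_separating
    (L := {p | HasPoleAt (barnesLeftFactor a b c d f g) p})
    (R := {p | HasPoleAt (barnesRightFactor e) p}) (M := M) (by
      rw [disjoint_left]
      intro p hL hR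
      -- A point with `s + p = -m` that is also `n` or `1 - e + n` would make `s` or `1 + s - e`
      -- equal to `-(m + n)`.
      have key : ∀ s : ℂ, ¬ IsNonposInt s → ¬ IsNonposInt (1 + s - e) → ¬ IsNonposInt (s + p) := by
        rintro s hs hse ⟨m, hm⟩
        rcases hR.barnesRightFactor with ⟨n, hn⟩ | ⟨n, hn⟩
        · exact hse ⟨m + n, by push_cast; linear_combination hm + hn⟩
        · exact hs ⟨m + n, by push_cast; linear_combination hm + hn⟩
      rcases hL.barnesLeftFactor with h | h | h | h
      exacts [key a ha hae h, key b hb hbe h, key c hc hce h, key d hd hde h])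
    (fun p hp => by have := HasPoleAt.re_le_of_barnesLeftFactor hp; linarith)
    (fun p hp => by have := HasPoleAt.le_re_of_barnesRightFactor hp; linarith) (by positivity)
    (finite_poles_barnesLeftFactor a b c d f g _) (finite_poles_barnesRightFactor e _)
  exact ⟨γ, h1, h2, h3⟩

/-! ### Residues at the right poles and the hypergeometric terms -/

theorem sin_pi_mul_add_nat (z : ℂ) (n : ℕ) : sin (Real.pi * (z + n)) = (-1) ^ n * sin (Real.pi * z) := by
  have := Complex.sin_antiperiodic.add_nat_mul_eq (x := Real.pi * z) n
  rw [← this]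
  congr 1
  ring

theorem tendsto_sub_mul_pi_div_sin (n : ℕ) :
    Tendsto (fun t : ℂ => (t - n) * (Real.pi / sin (Real.pi * t))) (𝓝[≠] (n : ℂ)) (𝓝 ((-1) ^ n)) := by
  have hpi : (Real.pi : ℂ) ≠ 0 := ofReal_ne_zero.mpr Real.pi_ne_zero
  have hcos : cos (Real.pi * n) = (-1) ^ n := by
    have := Complex.cos_antiperiodic.add_nat_mul_eq (x := 0) n
    rw [zero_add, cos_zero, mul_one] at this
    rw [← this, mul_comm]
  have hsin : sin (Real.pi * n) = 0 := by rw [mul_comm]; exact sin_nat_mul_pi n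
  have h1 : HasDerivAt (fun t : ℂ => sin (Real.pi * t)) (cos (Real.pi * n) * (Real.pi * 1)) n :=
    ((hasDerivAt_id (n : ℂ)).const_mul (Real.pi : ℂ)).csin
  rw [hasDerivAt_iff_tendsto_slope, hcos] at h1
  have hne : ((-1) ^ n * (Real.pi * 1) : ℂ) ≠ 0 := by simp [hpi]
  have h2 := (h1.inv₀ hne).const_mul (Real.pi : ℂ)
  have e : (Real.pi : ℂ) * ((-1 : ℂ) ^ n * ((Real.pi : ℂ) * 1))⁻¹ = (-1 : ℂ) ^ n := by
    have h3 : ((-1) ^ n * (-1) ^ n : ℂ) = 1 := by rw [← mul_pow]; simp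
    have h4 : ((-1) ^ n : ℂ) ≠ 0 := by simp
    field_simp
    linear_combination -h3
  rw [e] at h2
  refine h2.congr fun t => ?_
  rw [slope_def_field, hsin, sub_zero, inv_div]
  ring

theorem barnesRightFactor_eq {e t : ℂ} (h1 : ¬ IsNonposInt (1 + t)) (h2 : ¬ IsNonposInt (e + t)) :
    barnesRightFactor e t = -(Real.pi / sin (Real.pi * (e + t)) * (Real.pi / sin (Real.pi * t))) *
      ((Gamma (e + t))⁻¹ * (Gamma (1 + t))⁻¹) := by
  rw [barnesRightFactor, Gamma_neg_eq h1, Gamma_one_sub_sub_eq h2]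
  ring

theorem eventually_not_isNonposInt_add {s p : ℂ} (h : ¬ IsNonposInt (s + p)) :
    ∀ᶠ t in 𝓝 p, ¬ IsNonposInt (s + t) := by
  have hc : ContinuousAt (fun t => (Gamma (s + t))⁻¹) p :=
    ((analyticAt_Gamma_inv (s + p)).fun_comp (by fun_prop : AnalyticAt ℂ (fun t => s + t) p)).continuousAt
  filter_upwards [hc.eventually_ne (inv_ne_zero (Gamma_ne_zero_of_not_isNonposInt h))] with t ht hcon
  exact ht (by rw [inv_eq_zero]; exact (Gamma_eq_zero_iff _).mpr hcon)

theorem tendsto_Gamma_inv_mul (e p : ℂ) : Tendsto (fun t => (Gamma (e + t))⁻¹ * (Gamma (1 + t))⁻¹)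
    (𝓝[≠] p) (𝓝 ((Gamma (e + p))⁻¹ * (Gamma (1 + p))⁻¹)) := by
  have hc : ∀ s : ℂ, ContinuousAt (fun t => (Gamma (s + t))⁻¹) p := fun s =>
    ((analyticAt_Gamma_inv (s + p)).fun_comp (by fun_prop : AnalyticAt ℂ (fun t => s + t) p)).continuousAt
  exact ((hc e).mul (hc 1)).tendsto.mono_left nhdsWithin_le_nhds

/-- The residue `(-1) ^ n` of `π / sin (πt)` cancels the sign in `sin (π(e + n)) = (-1) ^ n sin
(πe)`. -/
theorem tendsto_sub_mul_barnesRightFactor_nat {e : ℂ} (he : ∀ n : ℤ, e ≠ n) (n : ℕ) :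
    Tendsto (fun t => (t - n) * barnesRightFactor e t) (𝓝[≠] (n : ℂ))
      (𝓝 (-(Real.pi / sin (Real.pi * e)) * ((Gamma (e + n))⁻¹ * (Gamma (1 + n))⁻¹))) := by
  have h1 : ¬ IsNonposInt (1 + n : ℂ) := not_isNonposInt_of_re_pos (by simp; positivity)
  have h2 := not_isNonposInt_add_natCast_of_forall_int he n
  have hs := sin_pi_mul_ne_zero_of_forall_int he
  have hm : ((-1) ^ n : ℂ) ≠ 0 := by simp
  have hsn : sin (Real.pi * (e + n)) ≠ 0 := by
    rw [sin_pi_mul_add_nat]; exact mul_ne_zero hm hs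
  have h3 : Tendsto (fun t : ℂ => (Real.pi / sin (Real.pi * (e + t)) : ℂ)) (𝓝[≠] (n : ℂ))
      (𝓝 (Real.pi / sin (Real.pi * (e + n)))) := by
    have : ContinuousAt (fun t : ℂ => (Real.pi / sin (Real.pi * (e + t)) : ℂ)) n :=
      continuousAt_const.div (by fun_prop) hsn
    exact this.tendsto.mono_left nhdsWithin_le_nhds
  have h4 := ((h3.mul (tendsto_sub_mul_pi_div_sin n)).neg).mul (tendsto_Gamma_inv_mul e n)
  have e1 : -(Real.pi / sin (Real.pi * (e + n)) * (-1) ^ n : ℂ) = -(Real.pi / sin (Real.pi * e)) := by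
    rw [sin_pi_mul_add_nat]; field_simp
  rw [e1] at h4
  refine h4.congr' ?_
  filter_upwards [nhdsWithin_le_nhds (eventually_not_isNonposInt_add h1),
    nhdsWithin_le_nhds (eventually_not_isNonposInt_add h2)] with t ht1 ht2
  rw [barnesRightFactor_eq ht1 ht2]
  ring

/-- Here `π / sin (π(e + t))` has the pole, at `e + t = n + 1`, with residue `(-1) ^ (n + 1)`, while
the other sine is `(-1) ^ n sin (πe)`. The extra sign is the origin of the minus sign between the
two series in `L`. -/
theorem tendsto_sub_mul_barnesRightFactor_one_sub {e : ℂ} (he : ∀ n : ℤ, e ≠ n) (n : ℕ) :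
    Tendsto (fun t => (t - (1 - e + n)) * barnesRightFactor e t) (𝓝[≠] (1 - e + n : ℂ))
      (𝓝 (Real.pi / sin (Real.pi * e) *
        ((Gamma (e + (1 - e + n)))⁻¹ * (Gamma (1 + (1 - e + n)))⁻¹))) := by
  have h1 : ¬ IsNonposInt (1 + (1 - e + n)) := by
    have := not_isNonposInt_two_sub he n
    rwa [show (2 - e + n : ℂ) = 1 + (1 - e + n) by ring] at this
  have h2 : ¬ IsNonposInt (e + (1 - e + n)) := by
    rw [show e + (1 - e + n) = 1 + n by ring]
    exact not_isNonposInt_of_re_pos (by simp; positivity)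
  have hs := sin_pi_mul_ne_zero_of_forall_int he
  have hm : ((-1) ^ n : ℂ) ≠ 0 := by simp
  have hsp : sin (Real.pi * (1 - e + n)) = (-1) ^ n * sin (Real.pi * e) := by
    rw [sin_pi_mul_add_nat, mul_sub, mul_one, sin_pi_sub]
  have hsn : sin (Real.pi * (1 - e + n)) ≠ 0 := by
    rw [hsp]; exact mul_ne_zero hm hs
  have h3 : Tendsto (fun t : ℂ => (Real.pi / sin (Real.pi * t) : ℂ)) (𝓝[≠] (1 - e + n : ℂ))
      (𝓝 (Real.pi / sin (Real.pi * (1 - e + n)))) := by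
    have : ContinuousAt (fun t : ℂ => (Real.pi / sin (Real.pi * t) : ℂ)) (1 - e + n) :=
      continuousAt_const.div (by fun_prop) hsn
    exact this.tendsto.mono_left nhdsWithin_le_nhds
  have hshift : Tendsto (fun t : ℂ => e + t) (𝓝[≠] (1 - e + n : ℂ)) (𝓝[≠] ((n + 1 : ℕ) : ℂ)) := by
    refine tendsto_nhdsWithin_iff.mpr ⟨?_, ?_⟩
    · have : Tendsto (fun t : ℂ => e + t) (𝓝 (1 - e + n : ℂ)) (𝓝 (e + (1 - e + n))) :=
        tendsto_id.const_add e
      rw [show e + (1 - e + n) = ((n + 1 : ℕ) : ℂ) by push_cast; ring] at this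
      exact this.mono_left nhdsWithin_le_nhds
    · filter_upwards [self_mem_nhdsWithin] with t ht hcon
      refine ht ?_
      rw [mem_singleton_iff] at hcon ⊢
      push_cast at hcon
      linear_combination hcon
  have h5 := (tendsto_sub_mul_pi_div_sin (n + 1)).comp hshift
  have h4 := ((h3.mul h5).neg).mul (tendsto_Gamma_inv_mul e (1 - e + n))
  have e1 : -(Real.pi / sin (Real.pi * (1 - e + n)) * (-1) ^ (n + 1) : ℂ) =
      Real.pi / sin (Real.pi * e) := by
    rw [hsp, pow_succ]; field_simp
  rw [e1] at h4
  refine h4.congr' ?_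
  filter_upwards [nhdsWithin_le_nhds (eventually_not_isNonposInt_add h1),
    nhdsWithin_le_nhds (eventually_not_isNonposInt_add h2)] with t ht1 ht2
  rw [barnesRightFactor_eq ht1 ht2]
  simp only [Function.comp]
  push_cast
  ring

/-- The function whose values at the poles `p` of `Γ(1 - e - t) Γ(-t)` are, up to the constant factor
`∓π / sin (π e)`, the residues of the Barnes integrand. -/
noncomputable def barnesResidueFactor (a b c d e f g t : ℂ) : ℂ :=
  barnesLeftFactor a b c d f g t * ((Gamma (e + t))⁻¹ * (Gamma (1 + t))⁻¹)

/-- Used at `t = 0` and `t = 1 - e`, where the Pochhammer quotients are the terms of the two series.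
-/
theorem barnesResidueFactor_add_nat {a b c d e f g t : ℂ} (ha : ¬ IsNonposInt (a + t))
    (hb : ¬ IsNonposInt (b + t)) (hc : ¬ IsNonposInt (c + t)) (hd : ¬ IsNonposInt (d + t))
    (he : ¬ IsNonposInt (e + t)) (hf : ¬ IsNonposInt (f + t)) (hg : ¬ IsNonposInt (g + t))
    (h1 : ¬ IsNonposInt (1 + t)) (n : ℕ) :
    barnesResidueFactor a b c d e f g (t + n) = barnesResidueFactor a b c d e f g t *
      pochhammerRatio ![a + t, b + t, c + t, d + t] ![e + t, f + t, g + t, 1 + t] n := by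
  simp only [barnesResidueFactor, barnesLeftFactor, ← add_assoc]
  rw [Gamma_add_nat ha, Gamma_add_nat hb, Gamma_add_nat hc, Gamma_add_nat hd, Gamma_add_nat he,
    Gamma_add_nat hf, Gamma_add_nat hg, Gamma_add_nat h1]
  simp only [pochhammerRatio, Fin.prod_univ_four, Matrix.cons_val, div_eq_mul_inv, mul_inv]
  ring

theorem hypergeometricTerm_eq_pochhammerRatio (a b c d e f g : ℂ) (n : ℕ) :
    hypergeometricTerm [a, b, c, d] [e, f, g] 1 n = pochhammerRatio ![a, b, c, d] ![e, f, g, 1] n := by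
  simp only [hypergeometricTerm, pochhammerRatio, Fin.prod_univ_four, Matrix.cons_val, List.map_cons,
    List.map_nil, List.prod_cons, List.prod_nil, ascPochhammer_eval_one, div_eq_mul_inv, mul_inv,
    one_pow]
  ring

/-- At `t = 1 - e` it is `e + t` that equals `1`, so in the second series `n!` stands in the first
lower place. -/
theorem hypergeometricTerm_swap (a b c d e f g : ℂ) (n : ℕ) :
    hypergeometricTerm [a, b, c, d] [f, g, e] 1 n = pochhammerRatio ![a, b, c, d] ![1, f, g, e] n := by
  simp only [hypergeometricTerm, pochhammerRatio, Fin.prod_univ_four, Matrix.cons_val, List.map_cons,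
    List.map_nil, List.prod_cons, List.prod_nil, ascPochhammer_eval_one, div_eq_mul_inv, mul_inv,
    one_pow]
  ring

/-! ### Behaviour of the integrand under `t ↦ t + 1` -/

/-- The integrand of the Barnes integral, without the derivative of the path. -/
noncomputable def barnesProduct (a b c d e f g t : ℂ) : ℂ :=
  barnesLeftFactor a b c d f g t * barnesRightFactor e t

/-- The factors `Γ(1-e-t)` and `Γ(-t)` contribute `-(e+t)` and `-(1+t)`; the signs cancel, so these
act like two more lower parameters. -/
theorem barnesProduct_add_one_mul {a b c d e f g t : ℂ} (ha : a + t ≠ 0) (hb : b + t ≠ 0)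
    (hc : c + t ≠ 0) (hd : d + t ≠ 0) (he : e + t ≠ 0) (hf : f + t ≠ 0) (hg : g + t ≠ 0)
    (h1 : 1 + t ≠ 0) :
    barnesProduct a b c d e f g (t + 1) * ∏ i, (![e, f, g, 1] i + t) =
      barnesProduct a b c d e f g t * ∏ i, (![a, b, c, d] i + t) := by
  have e1 : Gamma (1 - e - t) = -(e + t) * Gamma (1 - e - (t + 1)) := by
    rw [show -(e + t) = 1 - e - (t + 1) by ring, ← Gamma_add_one (1 - e - (t + 1))]
    · congr 1; ring
    · rw [show 1 - e - (t + 1) = -(e + t) by ring]; exact neg_ne_zero.mpr he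
  have e2 : Gamma (-t) = -(1 + t) * Gamma (-(t + 1)) := by
    rw [show -(1 + t) = -(t + 1) by ring, ← Gamma_add_one (-(t + 1))]
    · congr 1; ring
    · rw [neg_ne_zero, add_comm]; exact h1
  simp only [barnesProduct, barnesLeftFactor, barnesRightFactor, Fin.prod_univ_four, Matrix.cons_val,
    ← add_assoc]
  rw [Gamma_add_one _ ha, Gamma_add_one _ hb, Gamma_add_one _ hc, Gamma_add_one _ hd,
    Gamma_add_one _ hf, Gamma_add_one _ hg, e1, e2]
  simp only [div_eq_mul_inv, mul_inv]
  field_simp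

theorem re_add_pos_of_abs_lt {s t : ℂ} {x : ℝ} (hs : |s.re| < x) (ht : x ≤ t.re) :
    0 < (s + t).re := by
  have := neg_abs_le s.re
  rw [add_re]
  linarith

theorem ne_zero_of_zero_lt_re {s : ℂ} (hs : 0 < s.re) : s ≠ 0 := fun h => by simp [h] at hs

theorem barnesProduct_add_nat {a b c d e f g t : ℂ} (ha : 0 < (a + t).re) (hb : 0 < (b + t).re)
    (hc : 0 < (c + t).re) (hd : 0 < (d + t).re) (he : 0 < (e + t).re) (hf : 0 < (f + t).re)
    (hg : 0 < (g + t).re) (h1 : 0 < (1 + t).re) (n : ℕ) :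
    barnesProduct a b c d e f g (t + n) = barnesProduct a b c d e f g t *
      pochhammerRatio (fun i => ![a, b, c, d] i + t) (fun i => ![e, f, g, 1] i + t) n := by
  induction n with
  | zero => simp [pochhammerRatio]
  | succ n ih =>
    have hpos : ∀ s : ℂ, 0 < (s + t).re → s + (t + n) ≠ 0 := fun s hs => by
      refine ne_zero_of_zero_lt_re ?_
      have : (0 : ℝ) ≤ n := n.cast_nonneg
      simp at hs ⊢
      linarith
    have h := barnesProduct_add_one_mul (hpos a ha) (hpos b hb) (hpos c hc) (hpos d hd) (hpos e he)
      (hpos f hf) (hpos g hg) (hpos 1 h1)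
    have hq : ∏ i, (![e, f, g, 1] i + (t + n)) ≠ 0 := by
      simp only [Fin.prod_univ_four, Matrix.cons_val]
      exact mul_ne_zero (mul_ne_zero (mul_ne_zero (hpos e he) (hpos f hf)) (hpos g hg)) (hpos 1 h1)
    rw [← eq_div_iff hq] at h
    rw [Nat.cast_succ, ← add_assoc, h, ih, mul_div_assoc, mul_assoc, ← Finset.prod_div_distrib,
      pochhammerRatio, pochhammerRatio, ← Finset.prod_mul_distrib]
    congr 1
    refine Finset.prod_congr rfl fun i _ => ?_
    rw [ascPochhammer_succ_eval, ascPochhammer_succ_eval, mul_div_mul_comm, add_assoc, add_assoc]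

/-- The bound is uniform in `im t`, which makes one vertical line dominate all its translates by
natural numbers. -/
theorem exists_norm_barnesProduct_add_one_le {a b c d e f g : ℂ}
    (hS : e + f + g - a - b - c - d = 1) : ∃ x₀ : ℝ, ∀ t : ℂ, x₀ ≤ t.re →
      ‖barnesProduct a b c d e f g (t + 1)‖ ≤ ‖barnesProduct a b c d e f g t‖ := by
  obtain ⟨x₀, hx₀⟩ := exists_norm_prod_add_le ![a, b, c, d] ![e, f, g, 1] (by
    simp only [Fin.sum_univ_four, Matrix.cons_val]
    linear_combination hS)
  set X := |a.re| + |b.re| + |c.re| + |d.re| + |e.re| + |f.re| + |g.re| + |(1 : ℂ).re| + 1 with hX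
  refine ⟨max x₀ X, fun t ht => ?_⟩
  have ht1 := (le_max_left _ _).trans ht
  have ht2 := (le_max_right _ _).trans ht
  have := abs_nonneg a.re
  have := abs_nonneg b.re
  have := abs_nonneg c.re
  have := abs_nonneg d.re
  have := abs_nonneg e.re
  have := abs_nonneg f.re
  have := abs_nonneg g.re
  have := abs_nonneg (1 : ℂ).re
  have hne : ∀ s : ℂ, |s.re| < X → s + t ≠ 0 := fun s hs =>
    ne_zero_of_zero_lt_re (re_add_pos_of_abs_lt hs ht2)
  have he := hne e (by linarith)
  have hf := hne f (by linarith)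
  have hg := hne g (by linarith)
  have h1 := hne 1 (by linarith)
  have h := congrArg norm (barnesProduct_add_one_mul (hne a (by linarith)) (hne b (by linarith))
    (hne c (by linarith)) (hne d (by linarith)) he hf hg h1)
  rw [norm_mul, norm_mul] at h
  have hq : 0 < ‖∏ i, (![e, f, g, 1] i + t)‖ := by
    rw [norm_pos_iff]
    simp only [Fin.prod_univ_four, Matrix.cons_val]
    exact mul_ne_zero (mul_ne_zero (mul_ne_zero he hf) hg) h1
  refine le_of_mul_le_mul_right ?_ hq
  rw [h]
  exact mul_le_mul_of_nonneg_left (hx₀ t ht1) (norm_nonneg _)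

/-! ### Pushing the contour to the right -/

/-- With `θ = re e` this yields a strip free of right poles, and so an open neighbourhood of the new
line that contains no further pole. The window of width `1/4` lies in the lower or upper half of a
unit interval according to the fractional part of `θ`. -/
theorem exists_Icc_avoiding_integers (θ B : ℝ) : ∃ x₀ x₁ : ℝ, B ≤ x₀ ∧ x₀ < x₁ ∧
    ∀ (k : ℤ) (x : ℝ), x ∈ Icc x₀ x₁ → x ≠ k ∧ x + θ ≠ k := by
  have hθ0 := Int.fract_nonneg θ
  have hθ1 := Int.fract_lt_one θ
  have hθ := Int.floor_add_fract θ
  have aux : ∀ (m k : ℤ) (x : ℝ), (m : ℝ) < x → x < m + 1 → x ≠ k := by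
    rintro m k x h1 h2 rfl
    have h3 : m < k := by exact_mod_cast h1
    have h4 : k < m + 1 := by exact_mod_cast h2
    omega
  by_cases h : Int.fract θ ≤ 1 / 2
  · refine ⟨⌈B⌉ + 1 / 8, ⌈B⌉ + 3 / 8, by linarith [Int.le_ceil B], by linarith, fun k x hx => ⟨?_, ?_⟩⟩
    · exact aux ⌈B⌉ k x (by linarith [hx.1]) (by linarith [hx.2])
    · refine aux (⌈B⌉ + ⌊θ⌋) k _ ?_ ?_ <;> push_cast <;> linarith [hx.1, hx.2]
  · refine ⟨⌈B⌉ + 5 / 8, ⌈B⌉ + 7 / 8, by linarith [Int.le_ceil B], by linarith, fun k x hx => ⟨?_, ?_⟩⟩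
    · exact aux ⌈B⌉ k x (by linarith [hx.1]) (by linarith [hx.2])
    · refine aux (⌈B⌉ + ⌊θ⌋ + 1) k _ ?_ ?_ <;> push_cast <;> linarith [hx.1, hx.2]

theorem analyticAt_barnesProduct_of_im {a b c d e f g t : ℂ}
    (ht : |a.im| + |b.im| + |c.im| + |d.im| + |e.im| + 1 ≤ |t.im|) :
    AnalyticAt ℂ (barnesProduct a b c d e f g) t := by
  have := abs_nonneg a.im
  have := abs_nonneg b.im
  have := abs_nonneg c.im
  have := abs_nonneg d.im
  have := abs_nonneg e.im
  have hne : ∀ s : ℂ, |s.im| + 1 ≤ |t.im| → ¬ IsNonposInt (s + t) := fun s hs =>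
    not_isNonposInt_of_im_ne_zero fun h => by
      rw [add_im, add_eq_zero_iff_eq_neg] at h
      rw [h, abs_neg] at hs
      linarith
  have hne' : ∀ s : ℂ, |s.im| + 1 ≤ |t.im| → ¬ IsNonposInt (s - t) := fun s hs =>
    not_isNonposInt_of_im_ne_zero fun h => by
      rw [sub_im, sub_eq_zero] at h
      rw [h] at hs
      linarith
  refine (analyticAt_barnesLeftFactor f g (hne a (by linarith)) (hne b (by linarith))
    (hne c (by linarith)) (hne d (by linarith))).fun_mul (analyticAt_barnesRightFactor
    (hne' (1 - e) (by simp; linarith)) ?_)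
  rw [← zero_sub]
  exact hne' 0 (by simp; linarith)

theorem meromorphic_barnesProduct (a b c d e f g : ℂ) : Meromorphic (barnesProduct a b c d e f g) :=
  fun t => (meromorphic_barnesLeftFactor a b c d f g t).mul (meromorphic_barnesRightFactor e t)

theorem hasPoleAt_barnesProduct {a b c d e f g p : ℂ}
    (h : HasPoleAt (barnesProduct a b c d e f g) p) :
    HasPoleAt (barnesLeftFactor a b c d f g) p ∨ HasPoleAt (barnesRightFactor e) p := by
  by_contra! hcon
  refine not_lt.mpr ?_ h
  refine (add_nonneg (not_lt.mp hcon.1) (not_lt.mp hcon.2)).trans_eq ?_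
  exact (meromorphicOrderAt_mul (meromorphic_barnesLeftFactor a b c d f g p)
    (meromorphic_barnesRightFactor e p)).symm

theorem LiesLeftOf.notMem_range {γ : ℝ → ℂ} {p : ℂ} (h : LiesLeftOf γ p) : p ∉ range γ := by
  obtain ⟨x₀, hx₀⟩ := h
  exact (hx₀ x₀ le_rfl).source_mem

theorem LiesRightOf.notMem_range {γ : ℝ → ℂ} {p : ℂ} (h : LiesRightOf γ p) : p ∉ range γ := by
  obtain ⟨x₀, hx₀⟩ := h
  exact (hx₀ x₀ le_rfl).source_mem

theorem hasPoleAt_barnesRightFactor_nat {e : ℂ} (he : ∀ n : ℤ, e ≠ n) (n : ℕ) :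
    HasPoleAt (barnesRightFactor e) n := by
  refine hasPoleAt_of_tendsto (meromorphic_barnesRightFactor e _) ?_
    (tendsto_sub_mul_barnesRightFactor_nat he n)
  have hpi : (Real.pi : ℂ) ≠ 0 := ofReal_ne_zero.mpr Real.pi_ne_zero
  have h1 : ¬ IsNonposInt (1 + n : ℂ) := not_isNonposInt_of_re_pos (by simp; positivity)
  exact mul_ne_zero (neg_ne_zero.mpr (div_ne_zero hpi (sin_pi_mul_ne_zero_of_forall_int he)))
    (mul_ne_zero (inv_ne_zero (Gamma_ne_zero_of_not_isNonposInt
      (not_isNonposInt_add_natCast_of_forall_int he n)))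
      (inv_ne_zero (Gamma_ne_zero_of_not_isNonposInt h1)))

theorem hasPoleAt_barnesRightFactor_one_sub {e : ℂ} (he : ∀ n : ℤ, e ≠ n) (n : ℕ) :
    HasPoleAt (barnesRightFactor e) (1 - e + n) := by
  refine hasPoleAt_of_tendsto (meromorphic_barnesRightFactor e _) ?_
    (tendsto_sub_mul_barnesRightFactor_one_sub he n)
  have hpi : (Real.pi : ℂ) ≠ 0 := ofReal_ne_zero.mpr Real.pi_ne_zero
  have h1 : ¬ IsNonposInt (1 + (1 - e + n)) := by
    have := not_isNonposInt_two_sub he n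
    rwa [show (2 - e + n : ℂ) = 1 + (1 - e + n) by ring] at this
  have h2 : ¬ IsNonposInt (e + (1 - e + n)) := by
    rw [show e + (1 - e + n) = 1 + n by ring]
    exact not_isNonposInt_of_re_pos (by simp; positivity)
  exact mul_ne_zero (div_ne_zero hpi (sin_pi_mul_ne_zero_of_forall_int he))
    (mul_ne_zero (inv_ne_zero (Gamma_ne_zero_of_not_isNonposInt h2))
      (inv_ne_zero (Gamma_ne_zero_of_not_isNonposInt h1)))

theorem tendsto_sub_mul_barnesProduct {a b c d e f g p r : ℂ} (ha : ¬ IsNonposInt (a + p))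
    (hb : ¬ IsNonposInt (b + p)) (hc : ¬ IsNonposInt (c + p)) (hd : ¬ IsNonposInt (d + p))
    (h : Tendsto (fun t => (t - p) * barnesRightFactor e t) (𝓝[≠] p) (𝓝 r)) :
    Tendsto (fun t => (t - p) * barnesProduct a b c d e f g t) (𝓝[≠] p)
      (𝓝 (barnesLeftFactor a b c d f g p * r)) := by
  have hL := (analyticAt_barnesLeftFactor f g ha hb hc hd).continuousAt.tendsto.mono_left
    (nhdsWithin_le_nhds (s := {p}ᶜ))
  exact (hL.mul h).congr fun t => by rw [barnesProduct]; ring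

theorem natCast_ne_one_sub_add {e : ℂ} (he : ∀ n : ℤ, e ≠ n) (m n : ℕ) : (m : ℂ) ≠ 1 - e + n :=
  fun h => he (1 + n - m) (by push_cast; linear_combination h)

/-- Moving the Barnes contour to the vertical line `re = x` far to the right. -/
theorem barnes_integral_sub_integral_line {a b c d e f g : ℂ} (he : ∀ n : ℤ, e ≠ n)
    (ha : ¬ IsNonposInt a) (hb : ¬ IsNonposInt b) (hc : ¬ IsNonposInt c) (hd : ¬ IsNonposInt d)
    (hae : ¬ IsNonposInt (1 + a - e)) (hbe : ¬ IsNonposInt (1 + b - e))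
    (hce : ¬ IsNonposInt (1 + c - e)) (hde : ¬ IsNonposInt (1 + d - e)) {γ : ℝ → ℂ}
    (hγ : IsBarnesContour (barnesLeftFactor a b c d f g) (barnesRightFactor e) γ) {x x' : ℝ}
    (hx0 : 0 ≤ x) (hxx' : x < x') (hγx : ∀ y, (γ y).re < x)
    (hxs : |a.re| + |b.re| + |c.re| + |d.re| < x)
    (hav : ∀ (k : ℤ) (u : ℝ), u ∈ Icc x x' → u ≠ k ∧ u + e.re ≠ k) :
    Integrable (fun y => barnesProduct a b c d e f g (γ y) * deriv γ y) ∧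
    Integrable (fun y : ℝ => barnesProduct a b c d e f g (x + y * I) *
      deriv (fun y : ℝ => (x + (y : ℂ) * I : ℂ)) y) ∧
    (∫ y, barnesProduct a b c d e f g (γ y) * deriv γ y) -
      ∫ y : ℝ, barnesProduct a b c d e f g (x + y * I) *
        deriv (fun y : ℝ => (x + (y : ℂ) * I : ℂ)) y =
      2 * Real.pi * I * (Real.pi / sin (Real.pi * e)) *
        (∑ n ∈ Finset.range ⌈x⌉₊, barnesResidueFactor a b c d e f g n -
          ∑ n ∈ Finset.range ⌈x - 1 + e.re⌉₊, barnesResidueFactor a b c d e f g (1 - e + n)) := by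
  classical
  set Φ := barnesProduct a b c d e f g with hΦ
  set H := barnesResidueFactor a b c d e f g with hH
  set κ : ℂ := Real.pi / sin (Real.pi * e) with hκ
  have hvγ := hγ.indented_axis.isVerticalPath
  obtain ⟨M, hM⟩ := hvγ.exists_bound_re
  have hinj' : Function.Injective (fun y : ℝ => (x + (y : ℂ) * I : ℂ)) := fun y z hyz => by
    have := congrArg im hyz
    simpa using this
  set P₁ : Finset ℂ := (Finset.range ⌈x⌉₊).image (fun n : ℕ => (n : ℂ)) with hP₁
  set P₂ : Finset ℂ := (Finset.range ⌈x - 1 + e.re⌉₊).image (fun n : ℕ => 1 - e + (n : ℂ)) with hP₂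
  have hmem₁ : ∀ p ∈ P₁, ∃ n : ℕ, p = n ∧ (n : ℝ) < x := fun p hp => by
    obtain ⟨n, hn, rfl⟩ := Finset.mem_image.mp hp
    exact ⟨n, rfl, Nat.lt_ceil.mp (Finset.mem_range.mp hn)⟩
  have hmem₂ : ∀ p ∈ P₂, ∃ n : ℕ, p = 1 - e + n ∧ (n : ℝ) < x - 1 + e.re := fun p hp => by
    obtain ⟨n, hn, rfl⟩ := Finset.mem_image.mp hp
    exact ⟨n, rfl, Nat.lt_ceil.mp (Finset.mem_range.mp hn)⟩
  have hdisj : Disjoint P₁ P₂ := by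
    rw [Finset.disjoint_left]
    intro p h1 h2
    obtain ⟨m, rfl, -⟩ := hmem₁ p h1
    obtain ⟨n, hn, -⟩ := hmem₂ _ h2
    exact natCast_ne_one_sub_add he m n hn
  -- Left poles may lie inside the strip as well, since the contour is indented; only finitely many
  -- lie right of `-M - 1`.
  set PL : Finset ℂ := (finite_poles_barnesLeftFactor a b c d f g (-M - 1)).toFinset with hPL
  set ρ : ℂ → ℂ := fun p => if p ∈ P₁ then -κ * H p else κ * H p with hρ
  have hright : ∀ p ∈ P₁ ∪ P₂, HasPoleAt (barnesRightFactor e) p ∧ p.re < x ∧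
      Tendsto (fun t => (t - p) * Φ t) (𝓝[≠] p) (𝓝 (ρ p)) := by
    intro p hp
    rcases Finset.mem_union.mp hp with hp | hp
    · have hρp : ρ p = -κ * H p := if_pos hp
      rw [hρp]
      obtain ⟨n, rfl, hn⟩ := hmem₁ p hp
      refine ⟨hasPoleAt_barnesRightFactor_nat he n, by simpa using hn, ?_⟩
      have hN : ∀ s : ℂ, ¬ IsNonposInt s → ¬ IsNonposInt (s + n) := fun s hs h =>
        hs h.of_add_natCast
      convert! tendsto_sub_mul_barnesProduct (f := f) (g := g) (hN a ha) (hN b hb) (hN c hc) (hN d hd)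
        (tendsto_sub_mul_barnesRightFactor_nat he n) using 2
      rw [hH, barnesResidueFactor]
      ring
    · have hρp : ρ p = κ * H p := if_neg (Finset.disjoint_right.mp hdisj hp)
      rw [hρp]
      obtain ⟨n, rfl, hn⟩ := hmem₂ p hp
      refine ⟨hasPoleAt_barnesRightFactor_one_sub he n, by simp; linarith, ?_⟩
      have hN : ∀ s : ℂ, ¬ IsNonposInt (1 + s - e) → ¬ IsNonposInt (s + (1 - e + n)) := fun s hs h =>
        hs (IsNonposInt.of_add_natCast (n := n)
          (by rwa [show 1 + s - e + n = s + (1 - e + n) by ring]))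
      convert! tendsto_sub_mul_barnesProduct (f := f) (g := g) (hN a hae) (hN b hbe) (hN c hce)
        (hN d hde) (tendsto_sub_mul_barnesRightFactor_one_sub he n) using 2
      rw [hH, barnesResidueFactor]
      ring
  have hleft : ∀ p ∈ PL, HasPoleAt (barnesLeftFactor a b c d f g) p ∧ p.re < x := fun p hp => by
    rw [hPL, Set.Finite.mem_toFinset] at hp
    exact ⟨hp.1, hp.1.re_le_of_barnesLeftFactor.trans_lt hxs⟩
  choose m cc hmc using fun p => (meromorphic_barnesProduct a b c d e f g p).exists_principalPart
  -- Along the new line every pole counts `πi`. Left poles therefore contribute `πi - πi = 0`, and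
  -- right poles `-πi - πi = -2πi` times the residue.
  set w : ℂ → ℂ := fun p => if p ∈ P₁ ∪ P₂ then -(Real.pi * I) else Real.pi * I with hw
  obtain ⟨C, T, hCT⟩ := exists_norm_barnes_le a b c d e f g 0 x
  have hmain := integral_sub_integral_eq_sum_residues hx0 hvγ (isVerticalPath_line x)
    hγ.indented_axis.injective hinj' (x₁ := -M - 1) (x₂ := x') (f := Φ)
    (fun y => ⟨by linarith [(abs_le.mp (hM y)).1], (hγx y).trans hxx'⟩)
    (fun y => by
      have := (abs_le.mp (hM 0)).1
      have := hγx 0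
      simp only [mem_preimage, add_re, ofReal_re, mul_re, I_re, I_im, ofReal_im, mem_Ioo]
      constructor <;> linarith)
    (meromorphic_barnesProduct a b c d e f g).meromorphicOn ((P₁ ∪ P₂) ∪ PL)
    -- Right poles are simple with explicit residue `ρ`; at left poles any principal part will do,
    -- because its contribution cancels.
    (fun p => if p ∈ P₁ ∪ P₂ then 0 else m p)
    (fun p => if p ∈ P₁ ∪ P₂ then (fun _ => ρ p) else cc p)
    (fun p _ => by
      by_cases hp : p ∈ P₁ ∪ P₂
      · simp only [if_pos hp]
        exact meromorphicOrderAt_sub_simple_pole (meromorphic_barnesProduct a b c d e f g p)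
          (hright p hp).2.2
      · simp only [if_neg hp]
        exact hmc p)
    (fun z hz hzP => by
      by_contra hcon
      refine hzP ?_
      rcases hasPoleAt_barnesProduct (not_le.mp hcon) with hz1 | hz1
      · refine Finset.mem_union_right _ ?_
        rw [hPL, Set.Finite.mem_toFinset]
        exact ⟨hz1, hz.1.le⟩
      · refine Finset.mem_union_left _ ?_
        rcases hz1.barnesRightFactor with ⟨n, hn⟩ | ⟨n, hn⟩
        · have hzn : z = 1 - e + n := by linear_combination -hn
          refine Finset.mem_union_right _ (Finset.mem_image.mpr ⟨n, ?_, hzn.symm⟩)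
          rw [Finset.mem_range, Nat.lt_ceil]
          have hre : z.re = 1 - e.re + n := by rw [hzn]; simp
          -- Otherwise `re z` lies in `[x, x']` while `re z + re e = 1 + n` is an integer.
          by_contra hle
          refine (hav (1 + n) z.re ⟨by linarith, hz.2.le⟩).2 ?_
          push_cast
          linarith
        · have hzn : z = n := by linear_combination -hn
          refine Finset.mem_union_left _ (Finset.mem_image.mpr ⟨n, ?_, hzn.symm⟩)
          rw [Finset.mem_range, Nat.lt_ceil]
          have hre : z.re = n := by rw [hzn]; simp
          by_contra hle
          refine (hav n z.re ⟨by linarith, hz.2.le⟩).1 ?_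
          push_cast
          exact hre)
    (w := w) (w' := fun _ => Real.pi * I)
    (fun p hp => by
      rcases Finset.mem_union.mp hp with hp | hp
      · exact (hγ.poles_right p (hright p hp).1).notMem_range
      · exact (hγ.poles_left p (hleft p hp).1).notMem_range)
    (fun p hp => by
      have hpx : p.re < x := by
        rcases Finset.mem_union.mp hp with hp | hp
        exacts [(hright p hp).2.1, (hleft p hp).2]
      rintro ⟨y, rfl⟩
      simp at hpx)
    (fun p hp => by
      by_cases hp' : p ∈ P₁ ∪ P₂
      · simp only [hw, if_pos hp']
        exact hvγ.hasPVIntegral_of_liesRightOf (hγ.poles_right p (hright p hp').1)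
      · simp only [hw, if_neg hp']
        exact hvγ.hasPVIntegral_of_liesLeftOf (hγ.poles_left p
          (hleft p ((Finset.mem_union.mp hp).resolve_left hp')).1))
    (fun p hp => by
      refine hasPVIntegral_verticalLine_of_lt ?_
      rcases Finset.mem_union.mp hp with hp | hp
      exacts [(hright p hp).2.1, (hleft p hp).2])
    (C := C) (T := max T (|a.im| + |b.im| + |c.im| + |d.im| + |e.im| + 1))
    (fun t ht hT => ⟨analyticAt_barnesProduct_of_im ((le_max_right _ _).trans hT),
      hCT t ht ((le_max_left _ _).trans hT)⟩)
  refine ⟨hmain.1, hmain.2.1, hmain.2.2.trans ?_⟩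
  rw [← Finset.sum_subset (Finset.subset_union_left (s₁ := P₁ ∪ P₂) (s₂ := PL)) (fun p _ hp => by
    simp only [hw, if_neg hp, sub_self, mul_zero])]
  have hsum : ∑ p ∈ P₁ ∪ P₂, (if p ∈ P₁ ∪ P₂ then (fun _ : ℕ => ρ p) else cc p) 0 *
      (w p - Real.pi * I) = ∑ p ∈ P₁ ∪ P₂, ρ p * (-(2 * Real.pi * I)) := by
    refine Finset.sum_congr rfl fun p hp => ?_
    simp only [hw, if_pos hp]
    ring
  rw [hsum, Finset.sum_union hdisj]
  have hs₁ : ∑ p ∈ P₁, ρ p * (-(2 * Real.pi * I)) =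
      ∑ n ∈ Finset.range ⌈x⌉₊, 2 * Real.pi * I * κ * H n := by
    rw [Finset.sum_congr rfl fun p hp => by rw [show ρ p = -κ * H p from if_pos hp], hP₁,
      Finset.sum_image fun m _ n _ h => Nat.cast_injective h]
    exact Finset.sum_congr rfl fun n _ => by ring
  have hs₂ : ∑ p ∈ P₂, ρ p * (-(2 * Real.pi * I)) =
      -∑ n ∈ Finset.range ⌈x - 1 + e.re⌉₊, 2 * Real.pi * I * κ * H (1 - e + n) := by
    rw [Finset.sum_congr rfl fun p hp => by
      rw [show ρ p = κ * H p from if_neg (Finset.disjoint_right.mp hdisj hp)], hP₂,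
      Finset.sum_image fun m _ n _ h => Nat.cast_injective (add_left_cancel h),
      ← Finset.sum_neg_distrib]
    exact Finset.sum_congr rfl fun n _ => by ring
  rw [hs₁, hs₂, ← Finset.mul_sum, ← Finset.mul_sum]
  ring

theorem norm_barnesProduct_add_nat_le {a b c d e f g : ℂ} {x₀ : ℝ}
    (h : ∀ t : ℂ, x₀ ≤ t.re →
      ‖barnesProduct a b c d e f g (t + 1)‖ ≤ ‖barnesProduct a b c d e f g t‖)
    {t : ℂ} (ht : x₀ ≤ t.re) (n : ℕ) :
    ‖barnesProduct a b c d e f g (t + n)‖ ≤ ‖barnesProduct a b c d e f g t‖ := by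
  induction n with
  | zero => simp
  | succ n ih =>
    refine le_trans ?_ ih
    rw [Nat.cast_succ, ← add_assoc]
    refine h _ ?_
    simp only [add_re, natCast_re]
    have : (0 : ℝ) ≤ n := n.cast_nonneg
    linarith

theorem tendsto_barnesProduct_add_nat {a b c d e f g t : ℂ} (hS : e + f + g - a - b - c - d = 1)
    (ha : 0 < (a + t).re) (hb : 0 < (b + t).re)
    (hc : 0 < (c + t).re) (hd : 0 < (d + t).re) (he : 0 < (e + t).re) (hf : 0 < (f + t).re)
    (hg : 0 < (g + t).re) (h1 : 0 < (1 + t).re) :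
    Tendsto (fun n : ℕ => barnesProduct a b c d e f g (t + n)) atTop (𝓝 0) := by
  have h := (tendsto_pochhammerRatio_zero (p := fun i => ![a, b, c, d] i + t)
    (q := fun i => ![e, f, g, 1] i + t) (fun i => not_isNonposInt_of_re_pos (by
      fin_cases i <;> assumption)) (by
      simp only [Fin.sum_univ_four, Matrix.cons_val]
      linear_combination hS)).const_mul (barnesProduct a b c d e f g t)
  rw [mul_zero] at h
  exact h.congr fun n => (barnesProduct_add_nat ha hb hc hd he hf hg h1 n).symm

/-- The Barnes integral as a sum over the residues to the right of the contour. -/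
theorem barnes_integral_eq {a b c d e f g : ℂ} (hS : e + f + g - a - b - c - d = 1)
    (he : ∀ n : ℤ, e ≠ n)
    (ha : ¬ IsNonposInt a) (hb : ¬ IsNonposInt b) (hc : ¬ IsNonposInt c) (hd : ¬ IsNonposInt d)
    (hae : ¬ IsNonposInt (1 + a - e)) (hbe : ¬ IsNonposInt (1 + b - e))
    (hce : ¬ IsNonposInt (1 + c - e)) (hde : ¬ IsNonposInt (1 + d - e)) {γ : ℝ → ℂ}
    (hγ : IsBarnesContour (barnesLeftFactor a b c d f g) (barnesRightFactor e) γ) {A B : ℂ}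
    (hA : HasSum (fun n : ℕ => barnesResidueFactor a b c d e f g n) A)
    (hB : HasSum (fun n : ℕ => barnesResidueFactor a b c d e f g (1 - e + n)) B) :
    Integrable (fun y => barnesProduct a b c d e f g (γ y) * deriv γ y) ∧
    ∫ y, barnesProduct a b c d e f g (γ y) * deriv γ y =
      2 * Real.pi * I * (Real.pi / sin (Real.pi * e)) * (A - B) := by
  obtain ⟨x₁, hx₁⟩ := exists_norm_barnesProduct_add_one_le hS
  obtain ⟨M, hM⟩ := hγ.indented_axis.isVerticalPath.exists_bound_re
  set X := |a.re| + |b.re| + |c.re| + |d.re| + |e.re| + |f.re| + |g.re| + |(1 : ℂ).re| + 1 with hX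
  have := abs_nonneg a.re
  have := abs_nonneg b.re
  have := abs_nonneg c.re
  have := abs_nonneg d.re
  have := abs_nonneg e.re
  have := abs_nonneg f.re
  have := abs_nonneg g.re
  have := abs_nonneg (1 : ℂ).re
  obtain ⟨x, x', hBx, hxx', hav⟩ := exists_Icc_avoiding_integers e.re (max (max x₁ (M + 1)) X)
  have hxx₁ : x₁ ≤ x := ((le_max_left _ _).trans (le_max_left _ _)).trans hBx
  have hxM : M + 1 ≤ x := ((le_max_right _ _).trans (le_max_left _ _)).trans hBx
  have hxX : X ≤ x := (le_max_right _ _).trans hBx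
  -- Translation by `N` preserves the avoidance of integers, so the same window serves for every
  -- line `re = x + N`.
  have hshift : ∀ N : ℕ, _ := fun N => barnes_integral_sub_integral_line he ha hb hc hd hae hbe hce
    hde hγ (x := x + N) (x' := x' + N) (by have : (0 : ℝ) ≤ N := N.cast_nonneg; linarith)
    (by linarith) (fun y => by
      have : (0 : ℝ) ≤ N := N.cast_nonneg
      have := (abs_le.mp (hM y)).2
      linarith) (by have : (0 : ℝ) ≤ N := N.cast_nonneg; linarith) (fun k u hu => by
      obtain ⟨h1, h2⟩ := hav (k - N) (u - N) ⟨by linarith [hu.1], by linarith [hu.2]⟩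
      push_cast at h1 h2
      exact ⟨fun h => h1 (by linarith), fun h => h2 (by linarith)⟩)
  refine ⟨(hshift 0).1, ?_⟩
  set J : ℕ → ℂ := fun N => ∫ y : ℝ, barnesProduct a b c d e f g (((x + N : ℝ) : ℂ) + y * I) *
        deriv (fun y : ℝ => (((x + N : ℝ) : ℂ) + (y : ℂ) * I : ℂ)) y with hJ
  have hpt : ∀ (N : ℕ) (y : ℝ), ((x + N : ℝ) : ℂ) + y * I = (x + y * I) + N := fun N y => by
    push_cast; ring
  have hderiv : ∀ (u y : ℝ), deriv (fun y : ℝ => (u + (y : ℂ) * I : ℂ)) y = I := fun u y =>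
    (hasDerivAt_verticalLine u y).deriv
  -- Dominated convergence: the integrand on `re = x` is the majorant, and pointwise `Φ(t + N) → 0`
  -- because the Pochhammer quotients tend to `0`.
  have hJ0 : Tendsto J atTop (𝓝 0) := by
    have h := tendsto_integral_of_dominated_convergence (μ := volume)
      (F := fun (N : ℕ) (y : ℝ) => barnesProduct a b c d e f g (((x + N : ℝ) : ℂ) + y * I) *
        deriv (fun y : ℝ => (((x + N : ℝ) : ℂ) + (y : ℂ) * I : ℂ)) y) (f := fun _ => 0)
      (fun y : ℝ => ‖barnesProduct a b c d e f g (((x + (0 : ℕ) : ℝ) : ℂ) + y * I) *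
        deriv (fun y : ℝ => (((x + (0 : ℕ) : ℝ) : ℂ) + (y : ℂ) * I : ℂ)) y‖)
      (fun N => (hshift N).2.1.aestronglyMeasurable) (hshift 0).2.1.norm
      (fun N => Eventually.of_forall fun y => by
        rw [norm_mul, norm_mul, hderiv, hderiv, hpt, hpt, Nat.cast_zero, add_zero]
        gcongr
        exact norm_barnesProduct_add_nat_le hx₁ (by simpa using hxx₁) N)
      (Eventually.of_forall fun y => by
        have hpos : ∀ s : ℂ, |s.re| < X → 0 < (s + (x + y * I)).re := fun s hs =>
          re_add_pos_of_abs_lt hs (by simpa using hxX)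
        have h := (tendsto_barnesProduct_add_nat hS (hpos a (by linarith)) (hpos b (by linarith))
          (hpos c (by linarith)) (hpos d (by linarith)) (hpos e (by linarith))
          (hpos f (by linarith)) (hpos g (by linarith)) (hpos 1 (by linarith))).mul_const I
        rw [zero_mul] at h
        exact h.congr fun N => by rw [hderiv, hpt])
    rwa [integral_zero] at h
  -- The numbers of residues collected from both sequences tend to infinity, so the finite sums tend
  -- to `A` and `B`.
  have hceil : ∀ r : ℝ, Tendsto (fun N : ℕ => ⌈x + N + r⌉₊) atTop atTop := fun r => by
    refine tendsto_nat_ceil_atTop.comp ?_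
    exact tendsto_atTop_add_const_right _ _
      (tendsto_atTop_add_const_left _ _ tendsto_natCast_atTop_atTop)
  have hlim := ((hA.tendsto_sum_nat.comp (hceil 0)).sub
    (hB.tendsto_sum_nat.comp (hceil (-1 + e.re)))).const_mul
      (2 * Real.pi * I * (Real.pi / sin (Real.pi * e)))
  have hlim' := hJ0.const_sub (∫ y, barnesProduct a b c d e f g (γ y) * deriv γ y)
  rw [sub_zero] at hlim'
  refine tendsto_nhds_unique hlim' (hlim.congr fun N => ?_)
  have h := (hshift N).2.2
  rw [hJ]
  rw [h]
  simp only [Function.comp, add_zero]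
  rw [← add_assoc, ← sub_eq_add_neg]

/-! ### The integral representation of `L` -/

theorem proposition3p1 (a b c d e f g : ℂ)
    -- the Saalschützian condition
    (hS : e + f + g - a - b - c - d = 1)
    -- the two hypergeometric series and the factor `1 / sin (π e)` are defined
    (he : ∀ n : ℤ, e ≠ (n : ℂ))
    (hf : ¬ IsNonposInt f) (hg : ¬ IsNonposInt g)
    (hfe : ¬ IsNonposInt (1 + f - e)) (hge : ¬ IsNonposInt (1 + g - e))
    -- the condition under which the path of integration exists
    (ha : ¬ IsNonposInt a) (hb : ¬ IsNonposInt b)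
    (hc : ¬ IsNonposInt c) (hd : ¬ IsNonposInt d)
    (hae : ¬ IsNonposInt (1 + a - e)) (hbe : ¬ IsNonposInt (1 + b - e))
    (hce : ¬ IsNonposInt (1 + c - e)) (hde : ¬ IsNonposInt (1 + d - e)) :
    Summable (hypergeometricTerm [a, b, c, d] [e, f, g] 1) ∧
    Summable (hypergeometricTerm [1 + a - e, 1 + b - e, 1 + c - e, 1 + d - e]
      [1 + f - e, 1 + g - e, 2 - e] 1) ∧
    (∃ γ : ℝ → ℂ, IsBarnesContour (barnesLeftFactor a b c d f g) (barnesRightFactor e) γ) ∧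
    ∀ γ : ℝ → ℂ, IsBarnesContour (barnesLeftFactor a b c d f g) (barnesRightFactor e) γ →
      MeasureTheory.Integrable
        (barnesIntegrand (barnesLeftFactor a b c d f g) (barnesRightFactor e) γ) ∧
      LFunction a b c d e f g =
        1 / (Real.pi * Complex.Gamma a * Complex.Gamma b * Complex.Gamma c * Complex.Gamma d *
          Complex.Gamma (1 + a - e) * Complex.Gamma (1 + b - e) *
          Complex.Gamma (1 + c - e) * Complex.Gamma (1 + d - e)) *
        (1 / (2 * Real.pi * Complex.I) *
          barnesIntegral (barnesLeftFactor a b c d f g) (barnesRightFactor e) γ) := by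
  -- The parameter `1` standing for `n!` raises the Saalschützian excess from `1` to `2`.
  have hq₁ : ∑ i, ![e, f, g, 1] i - ∑ i, ![a, b, c, d] i = 2 := by
    simp only [Fin.sum_univ_four, Matrix.cons_val]
    linear_combination hS
  have hq₂ : ∑ i, ![1, 1 + f - e, 1 + g - e, 2 - e] i -
      ∑ i, ![1 + a - e, 1 + b - e, 1 + c - e, 1 + d - e] i = 2 := by
    simp only [Fin.sum_univ_four, Matrix.cons_val]
    linear_combination hS
  have hs₁ : Summable (hypergeometricTerm [a, b, c, d] [e, f, g] 1) :=
    (summable_pochhammerRatio (p := ![a, b, c, d]) (fun i => by fin_cases i <;> assumption)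
      hq₁).congr fun n => (hypergeometricTerm_eq_pochhammerRatio a b c d e f g n).symm
  have hs₂ : Summable (hypergeometricTerm [1 + a - e, 1 + b - e, 1 + c - e, 1 + d - e]
      [1 + f - e, 1 + g - e, 2 - e] 1) :=
    (summable_pochhammerRatio (p := ![1 + a - e, 1 + b - e, 1 + c - e, 1 + d - e])
      (fun i => by fin_cases i <;> assumption) hq₂).congr fun n =>
        (hypergeometricTerm_swap _ _ _ _ _ _ _ n).symm
  refine ⟨hs₁, hs₂, exists_contour ha hb hc hd hae hbe hce hde, fun γ hγ => ?_⟩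
  have he0 : ¬ IsNonposInt e := by simpa using not_isNonposInt_add_natCast_of_forall_int he 0
  have he2 : ¬ IsNonposInt (2 - e) := by simpa using not_isNonposInt_two_sub he 0
  have h1 : ¬ IsNonposInt 1 := not_isNonposInt_of_re_pos (by simp)
  have hA : HasSum (fun n : ℕ => barnesResidueFactor a b c d e f g n)
      (barnesResidueFactor a b c d e f g 0 * hypergeometricSeries [a, b, c, d] [e, f, g] 1) := by
    refine (hs₁.hasSum.mul_left _).congr_fun fun n => ?_
    have h := barnesResidueFactor_add_nat (a := a) (b := b) (c := c) (d := d) (e := e) (f := f)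
      (g := g) (t := 0) (by simpa) (by simpa) (by simpa) (by simpa) (by simpa) (by simpa) (by simpa)
      (by simpa) n
    simp only [zero_add, add_zero] at h
    rw [hypergeometricTerm_eq_pochhammerRatio, h]
  have hadd : ∀ s : ℂ, s + (1 - e) = 1 + s - e := fun s => by ring
  have h1e : (1 : ℂ) + (1 - e) = 2 - e := by ring
  have hee : e + (1 - e) = 1 := by ring
  have hB : HasSum (fun n : ℕ => barnesResidueFactor a b c d e f g (1 - e + n))
      (barnesResidueFactor a b c d e f g (1 - e) *
        hypergeometricSeries [1 + a - e, 1 + b - e, 1 + c - e, 1 + d - e]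
          [1 + f - e, 1 + g - e, 2 - e] 1) := by
    refine (hs₂.hasSum.mul_left _).congr_fun fun n => ?_
    have h := barnesResidueFactor_add_nat (a := a) (b := b) (c := c) (d := d) (e := e) (f := f)
      (g := g) (t := 1 - e) (by rwa [hadd]) (by rwa [hadd]) (by rwa [hadd]) (by rwa [hadd])
      (by rwa [hee]) (by rwa [hadd]) (by rwa [hadd]) (by rwa [h1e]) n
    rw [hee, h1e, hadd, hadd, hadd, hadd, hadd, hadd] at h
    rw [hypergeometricTerm_swap, h]
  obtain ⟨hint, heq⟩ := barnes_integral_eq hS he ha hb hc hd hae hbe hce hde hγ hA hB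
  refine ⟨hint, ?_⟩
  -- `barnesIntegral` unfolds to the integral of `barnesProduct`. In the prefactor, `H(0)` cancels
  -- `Γ(a)Γ(b)Γ(c)Γ(d)` and `H(1-e)` cancels the other four Gamma values, which leaves the two terms
  -- of `L`.
  have heq' : barnesIntegral (barnesLeftFactor a b c d f g) (barnesRightFactor e) γ = _ := heq
  rw [heq', LFunction]
  simp only [barnesResidueFactor, barnesLeftFactor, hee, h1e, add_zero, Gamma_one]
  simp only [hadd]
  have hpi : (Real.pi : ℂ) ≠ 0 := ofReal_ne_zero.mpr Real.pi_ne_zero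
  have hsin := sin_pi_mul_ne_zero_of_forall_int he
  have ga := Gamma_ne_zero_of_not_isNonposInt ha
  have gb := Gamma_ne_zero_of_not_isNonposInt hb
  have gc := Gamma_ne_zero_of_not_isNonposInt hc
  have gd := Gamma_ne_zero_of_not_isNonposInt hd
  have ge := Gamma_ne_zero_of_not_isNonposInt he0
  have gf := Gamma_ne_zero_of_not_isNonposInt hf
  have gg := Gamma_ne_zero_of_not_isNonposInt hg
  have gae := Gamma_ne_zero_of_not_isNonposInt hae
  have gbe := Gamma_ne_zero_of_not_isNonposInt hbe
  have gce := Gamma_ne_zero_of_not_isNonposInt hce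
  have gde := Gamma_ne_zero_of_not_isNonposInt hde
  have gfe := Gamma_ne_zero_of_not_isNonposInt hfe
  have gge := Gamma_ne_zero_of_not_isNonposInt hge
  have g2 := Gamma_ne_zero_of_not_isNonposInt he2
  have hI := I_ne_zero
  field_simp
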